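/- Let $k$ be a commutative ring, $A$ a (not necessarily commutative) $k$-algebra, and $(U,A)$ a left bialgebroid with source $s$, target $t$, coproduct $\Delta(u)=u_{(1)}\otimes u_{(2)}$ and counit $\epsilon$ (with $\epsilon(1)=1$). Write $a\triangleright u\triangleleft b=s(a)t(b)u$ and $a\blacktriangleright u\blacktriangleleft b=u\,t(a)s(b)$. Let $U^*=\{\varphi\in\mathrm{Hom}_k(U,A):\varphi(u\triangleleft a)=\varphi(u)a\}$ and $U_*=\{\psi\in\mathrm{Hom}_k(U,A):\psi(a\triangleright u)=a\psi(u)\}$ be its right and left dual, with the $A^e$-ring structures $$(\varphi\varphi')(u)=\varphi'\big(s(\varphi(u_{(1)}))u_{(2)}\big),\quad 1_{U^*}=\epsilon,\quad s^*(a)(u)=\epsilon(u\,s(a)),\quad t^*(a)(u)=a\,\epsilon(u),$$ $$(\psi\psi')(u)=\psi'\big(t(\psi(u_{(2)}))u_{(1)}\big),\quad 1_{U_*}=\epsilon,\quad s_*(a)(u)=\epsilon(u)a,\quad t_*(a)(u)=\epsilon(u\,t(a)),$$ and the augmentations $\varphi\mapsto\varphi(1)$, $\psi\mapsto\psi(1)$.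 Suppose that $U$ is both a left and a right Hopf algebroid, i.e. that the Hopf–Galois maps $\alpha_\ell:{}_\blacktriangleright U\otimes_{A^{op}}U_\triangleleft\to U_\triangleleft\otimes_A{}_\triangleright U$, $u\otimes v\mapsto u_{(1)}\otimes u_{(2)}v$, and $\alpha_r:U_\blacktriangleleft\otimes^A{}_\triangleright U\to U_\triangleleft\otimes_A{}_\triangleright U$, $u\otimes v\mapsto u_{(1)}v\otimes u_{(2)}$, are bijective, and write $u_+\otimes u_-=\alpha_\ell^{-1}(u\otimes1)$, $u_{[+]}\otimes u_{[-]}=\alpha_r^{-1}(1\otimes u)$. Define $$S^*:U^*\to U_*,\ S^*(\varphi)(u)=\epsilon\big(u_+\,t(\varphi(u_-))\big),\qquad S_*:U_*\to U^*,\ S_*(\psi)(u)=\epsilon\big(u_{[+]}\,s(\psi(u_{[-]}))\big).$$ Then $S^*$ and $S_*$ are morphisms of $A^e$-rings with augmentation, and they are inverse to each other. If, in addition, ${}_\triangleright U$ and $U_\triangleleft$ are finitely generated projective over $A$, then each of $U^*$ and $U_*$ carries exactly one right bialgebroid structure over $A$ with the above $A^e$-ring structure, counit the above augmentation and coproduct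 dual to the product of $U$, that is, $\varphi(uv)=\varphi^{(1)}\big(u\,t(\varphi^{(2)}(v))\big)$ and $\psi(uv)=\psi^{(2)}\big(u\,s(\psi^{(1)}(v))\big)$ for all $u,v\in U$; and for these structures $(S^*,\mathrm{id}_A)$ and $(S_*,\mathrm{id}_A)$ are mutually inverse isomorphisms of right bialgebroids. -/

import Mathlib

namespace Bialgebroid

open scoped TensorProduct
open MulOpposite

universe u v w w' w''

/-! ### Balanced tensor products over a noncommutative algebra -/

section BalTensor

variable {k : Type u} {A : Type v} [CommRing k]
variable {M M' N N' P : Type*} [AddCommGroup M] [Module k M] [AddCommGroup M'] [Module k M']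
  [AddCommGroup N] [Module k N] [AddCommGroup N'] [Module k N'] [AddCommGroup P] [Module k P]

/-- The submodule of `M ⊗[k] N` spanned by the elements `(m · a) ⊗ n - m ⊗ (a · n)`. -/
def balancedRel (ρ : A → Module.End k M) (l : A → Module.End k N) : Submodule k (M ⊗[k] N) :=
  Submodule.span k {z | ∃ a m n, z = ρ a m ⊗ₜ[k] n - m ⊗ₜ[k] l a n}

/-- The tensor product `M ⊗_A N` of `k`-modules with actions of `A`: the quotient of `M ⊗[k] N`
by the relations `(m · a) ⊗ n = m ⊗ (a · n)`, where `m · a = ρ a m` and `a · n = l a n`. -/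
def BalTensor (ρ : A → Module.End k M) (l : A → Module.End k N) :=
  (M ⊗[k] N) ⧸ balancedRel ρ l

instance (ρ : A → Module.End k M) (l : A → Module.End k N) : AddCommGroup (BalTensor ρ l) :=
  inferInstanceAs (AddCommGroup ((M ⊗[k] N) ⧸ balancedRel ρ l))

instance (ρ : A → Module.End k M) (l : A → Module.End k N) : Module k (BalTensor ρ l) :=
  inferInstanceAs (Module k ((M ⊗[k] N) ⧸ balancedRel ρ l))

namespace BalTensor

variable {ρ : A → Module.End k M} {l : A → Module.End k N}
  {ρ' : A → Module.End k M'} {l' : A → Module.End k N'}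

/-- The quotient map `M ⊗[k] N → M ⊗_A N`. -/
def proj (ρ : A → Module.End k M) (l : A → Module.End k N) : (M ⊗[k] N) →ₗ[k] BalTensor ρ l :=
  (balancedRel ρ l).mkQ

/-- The class of `m ⊗ n` in `M ⊗_A N`. -/
def tmul (ρ : A → Module.End k M) (l : A → Module.End k N) (m : M) (n : N) : BalTensor ρ l :=
  proj ρ l (m ⊗ₜ[k] n)

theorem tmul_add (m : M) (n n' : N) : tmul ρ l m (n + n') = tmul ρ l m n + tmul ρ l m n' := by
  simp only [tmul, TensorProduct.tmul_add, map_add]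

theorem add_tmul (m m' : M) (n : N) : tmul ρ l (m + m') n = tmul ρ l m n + tmul ρ l m' n := by
  simp only [tmul, TensorProduct.add_tmul, map_add]

theorem smul_tmul' (c : k) (m : M) (n : N) : tmul ρ l (c • m) n = c • tmul ρ l m n := by
  simp only [tmul, ← TensorProduct.smul_tmul', map_smul]

theorem tmul_smul (c : k) (m : M) (n : N) : tmul ρ l m (c • n) = c • tmul ρ l m n := by
  simp only [tmul, TensorProduct.tmul_smul, map_smul]

theorem tmul_balanced (a : A) (m : M) (n : N) : tmul ρ l (ρ a m) n = tmul ρ l m (l a n) := by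
  refine (Submodule.Quotient.eq _).2 (Submodule.subset_span ⟨a, m, n, rfl⟩)

/-- The class of `m ⊗ n` as a bilinear map. -/
def mk (ρ : A → Module.End k M) (l : A → Module.End k N) : M →ₗ[k] N →ₗ[k] BalTensor ρ l :=
  LinearMap.mk₂ k (tmul ρ l) add_tmul smul_tmul' tmul_add tmul_smul

@[simp] theorem mk_apply (m : M) (n : N) : mk ρ l m n = tmul ρ l m n := rfl

theorem induction {p : BalTensor ρ l → Prop} (x : BalTensor ρ l) (h0 : p 0)
    (ht : ∀ m n, p (tmul ρ l m n)) (ha : ∀ y z, p y → p z → p (y + z)) : p x := by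
  obtain ⟨z, rfl⟩ : ∃ z, proj ρ l z = x := Submodule.mkQ_surjective _ x
  induction z using TensorProduct.induction_on with
  | zero => simpa using h0
  | tmul m n => exact ht m n
  | add y z hy hz => rw [map_add]; exact ha _ _ hy hz

/-- The universal property: an `A`-balanced `k`-bilinear map factors through `M ⊗_A N`. -/
def lift (f : M →ₗ[k] N →ₗ[k] P) (hf : ∀ a m n, f (ρ a m) n = f m (l a n)) :
    BalTensor ρ l →ₗ[k] P :=
  (balancedRel ρ l).liftQ (TensorProduct.lift f) (by
    refine Submodule.span_le.2 ?_
    rintro _ ⟨a, m, n, rfl⟩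
    simp [hf])

@[simp] theorem lift_tmul (f : M →ₗ[k] N →ₗ[k] P) (hf) (m : M) (n : N) :
    lift (ρ := ρ) (l := l) f hf (tmul ρ l m n) = f m n := by
  exact TensorProduct.lift.tmul (f' := f) m n

theorem ext {f g : BalTensor ρ l →ₗ[k] P} (h : ∀ m n, f (tmul ρ l m n) = g (tmul ρ l m n)) :
    f = g := by
  ext x
  induction x using induction with
  | h0 => simp
  | ht m n => exact h m n
  | ha y z hy hz => simp only [map_add, hy, hz]

/-- The tensor product `f ⊗_A g` of two maps compatible with the actions of `A`. -/
def map (f : M →ₗ[k] M') (g : N →ₗ[k] N') (hf : ∀ a m, f (ρ a m) = ρ' a (f m))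
    (hg : ∀ a n, g (l a n) = l' a (g n)) : BalTensor ρ l →ₗ[k] BalTensor ρ' l' :=
  lift ((mk ρ' l').compl₁₂ f g) (by intro a m n; simp [hf, hg, tmul_balanced])

@[simp] theorem map_tmul (f : M →ₗ[k] M') (g : N →ₗ[k] N') (hf) (hg) (m : M) (n : N) :
    map (ρ := ρ) (l := l) (ρ' := ρ') (l' := l') f g hf hg (tmul ρ l m n) =
      tmul ρ' l' (f m) (g n) := by
  simp [map]

end BalTensor

end BalTensor

/-! ### Bimodules and corings -/

/-- An `(A, A)`-bimodule structure (with central action of `k`) on the `k`-module `C`. -/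
structure Bimod (k : Type u) (A : Type v) (C : Type w) [CommRing k] [Ring A] [Algebra k A]
    [AddCommGroup C] [Module k C] where
  /-- the left action, `l a x = a · x` -/
  l : A →ₐ[k] Module.End k C
  /-- the right action, `r (op a) x = x · a` -/
  r : Aᵐᵒᵖ →ₐ[k] Module.End k C
  comm : ∀ a b x, l a (r b x) = r b (l a x)

namespace Bimod

variable {k : Type u} {A : Type v} [CommRing k] [Ring A] [Algebra k A]
variable {C D G : Type*} [AddCommGroup C] [Module k C] [AddCommGroup D] [Module k D]
  [AddCommGroup G] [Module k G]

/-- The left action as a family of endomorphisms, `a ↦ (x ↦ a · x)`. -/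
def lAct (X : Bimod k A C) (a : A) : Module.End k C := X.l a

/-- The right action as a family of endomorphisms, `a ↦ (x ↦ x · a)`. -/
def rAct (X : Bimod k A C) (a : A) : Module.End k C := X.r (op a)

theorem lAct_apply (X : Bimod k A C) (a : A) (x : C) : X.lAct a x = X.l a x := rfl

theorem rAct_apply (X : Bimod k A C) (a : A) (x : C) : X.rAct a x = X.r (op a) x := rfl

theorem lAct_rAct (X : Bimod k A C) (a b : A) (x : C) :
    X.lAct a (X.rAct b x) = X.rAct b (X.lAct a x) := X.comm _ _ _

/-- The tensor product `C ⊗_A D` of two `(A, A)`-bimodules. -/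
abbrev Tensor (X : Bimod k A C) (Y : Bimod k A D) :=
  BalTensor X.rAct Y.lAct

/-- The left action of `A` on `C ⊗_A D`, `a · (x ⊗ y) = (a · x) ⊗ y`. -/
def tensorL (X : Bimod k A C) (Y : Bimod k A D) (a : A) : Module.End k (X.Tensor Y) :=
  BalTensor.map (X.lAct a) LinearMap.id (by intros; exact X.lAct_rAct _ _ _) (by intros; rfl)

/-- The right action of `A` on `C ⊗_A D`, `(x ⊗ y) · a = x ⊗ (y · a)`. -/
def tensorR (X : Bimod k A C) (Y : Bimod k A D) (a : A) : Module.End k (X.Tensor Y) :=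
  BalTensor.map LinearMap.id (Y.rAct a) (by intros; rfl)
    (by intros; exact (Y.lAct_rAct _ _ _).symm)

@[simp] theorem tensorL_tmul (X : Bimod k A C) (Y : Bimod k A D) (a : A) (x : C) (y : D) :
    X.tensorL Y a (BalTensor.tmul _ _ x y) = BalTensor.tmul _ _ (X.lAct a x) y :=
  BalTensor.map_tmul _ _ _ _ _ _

@[simp] theorem tensorR_tmul (X : Bimod k A C) (Y : Bimod k A D) (a : A) (x : C) (y : D) :
    X.tensorR Y a (BalTensor.tmul _ _ x y) = BalTensor.tmul _ _ x (Y.rAct a y) :=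
  BalTensor.map_tmul _ _ _ _ _ _

/-- The canonical map `(C ⊗_A D) ⊗_A G → C ⊗_A (D ⊗_A G)`, `(x ⊗ y) ⊗ z ↦ x ⊗ (y ⊗ z)`. -/
def assoc (X : Bimod k A C) (Y : Bimod k A D) (Z : Bimod k A G) :
    BalTensor (X.tensorR Y) Z.lAct →ₗ[k]
      BalTensor X.rAct (Y.tensorL Z) :=
  BalTensor.lift
    (BalTensor.lift
      (LinearMap.mk₂ k
        (fun x y => (BalTensor.mk X.rAct (Y.tensorL Z) x).comp
          (BalTensor.mk Y.rAct Z.lAct y))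
        (by intros; ext; simp)
        (by intros; ext; simp)
        (by intros; ext; simp [BalTensor.tmul_add])
        (by intros; ext; simp))
      (by
        intro a x y
        ext z
        have h := BalTensor.tmul_balanced (ρ := X.rAct) (l := Y.tensorL Z) a x
          (BalTensor.tmul Y.rAct Z.lAct y z)
        simp only [tensorL, BalTensor.map_tmul, LinearMap.id_apply] at h
        simpa using h))
    (by
      intro a m z
      induction m using BalTensor.induction with
      | h0 => simp
      | ha y z hy hz => simp only [map_add, LinearMap.add_apply, hy, hz]
      | ht x y =>
        have h := BalTensor.tmul_balanced (ρ := Y.rAct)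
          (l := Z.lAct) a y z
        simp only [tensorR, BalTensor.map_tmul, LinearMap.id_apply, BalTensor.lift_tmul,
          LinearMap.mk₂_apply, LinearMap.comp_apply, BalTensor.mk_apply]
        exact congrArg _ h)

@[simp] theorem assoc_tmul (X : Bimod k A C) (Y : Bimod k A D) (Z : Bimod k A G)
    (x : C) (y : D) (z : G) :
    X.assoc Y Z (BalTensor.tmul _ _ (BalTensor.tmul _ _ x y) z) =
      BalTensor.tmul _ _ x (BalTensor.tmul _ _ y z) := by
  simp [assoc]

end Bimod

namespace Bimod

variable {k : Type u} {A : Type v} [CommRing k] [Ring A] [Algebra k A]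
variable {C : Type w} [AddCommGroup C] [Module k C]

/-- The map `Δ ⊗_A id : C ⊗_A C → (C ⊗_A C) ⊗_A C` for a right `A`-linear `Δ`. -/
def mapL (X : Bimod k A C) (Δ : C →ₗ[k] X.Tensor X)
    (hΔ : ∀ a x, Δ (X.rAct a x) = X.tensorR X a (Δ x)) :
    X.Tensor X →ₗ[k] BalTensor (X.tensorR X) X.lAct :=
  BalTensor.map Δ LinearMap.id hΔ (by intros; rfl)

/-- The map `id ⊗_A Δ : C ⊗_A C → C ⊗_A (C ⊗_A C)` for a left `A`-linear `Δ`. -/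
def mapR (X : Bimod k A C) (Δ : C →ₗ[k] X.Tensor X)
    (hΔ : ∀ a x, Δ (X.lAct a x) = X.tensorL X a (Δ x)) :
    X.Tensor X →ₗ[k] BalTensor X.rAct (X.tensorL X) :=
  BalTensor.map LinearMap.id Δ (by intros; rfl) hΔ

@[simp] theorem mapL_tmul (X : Bimod k A C) (Δ : C →ₗ[k] X.Tensor X) (hΔ) (x y : C) :
    X.mapL Δ hΔ (BalTensor.tmul _ _ x y) = BalTensor.tmul _ _ (Δ x) y :=
  BalTensor.map_tmul _ _ _ _ _ _

@[simp] theorem mapR_tmul (X : Bimod k A C) (Δ : C →ₗ[k] X.Tensor X) (hΔ) (x y : C) :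
    X.mapR Δ hΔ (BalTensor.tmul _ _ x y) = BalTensor.tmul _ _ x (Δ y) :=
  BalTensor.map_tmul _ _ _ _ _ _

/-- The map `C ⊗_A C → C`, `x ⊗ y ↦ e(x) · y`, for a right `A`-linear `e : C → A`. -/
def contractL (X : Bimod k A C) (e : C →ₗ[k] A) (he : ∀ a x, e (X.rAct a x) = e x * a) :
    X.Tensor X →ₗ[k] C :=
  BalTensor.lift (X.l.toLinearMap ∘ₗ e) (by intro a m n; simp [he, lAct_apply])

/-- The map `C ⊗_A C → C`, `x ⊗ y ↦ x · e(y)`, for a left `A`-linear `e : C → A`. -/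
def contractR (X : Bimod k A C) (e : C →ₗ[k] A) (he : ∀ a x, e (X.lAct a x) = a * e x) :
    X.Tensor X →ₗ[k] C :=
  BalTensor.lift (X.r.toLinearMap ∘ₗ (opLinearEquiv k).toLinearMap ∘ₗ e).flip
    (by intro a m n; simp [he, rAct_apply])

@[simp] theorem contractL_tmul (X : Bimod k A C) (e : C →ₗ[k] A) (he) (x y : C) :
    X.contractL e he (BalTensor.tmul _ _ x y) = X.lAct (e x) y :=
  BalTensor.lift_tmul _ _ _ _

@[simp] theorem contractR_tmul (X : Bimod k A C) (e : C →ₗ[k] A) (he) (x y : C) :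
    X.contractR e he (BalTensor.tmul _ _ x y) = X.rAct (e y) x :=
  BalTensor.lift_tmul _ _ _ _

end Bimod

/-- An `A`-coring structure on the `(A, A)`-bimodule `X`: a coassociative and counital comonoid in
the monoidal category of `(A, A)`-bimodules. -/
@[ext]
structure ACoring {k : Type u} {A : Type v} {C : Type w} [CommRing k] [Ring A] [Algebra k A]
    [AddCommGroup C] [Module k C] (X : Bimod k A C) where
  /-- the coproduct, `x ↦ x₍₁₎ ⊗ x₍₂₎` -/
  comul : C →ₗ[k] X.Tensor X
  comul_l : ∀ (a : A) (x : C), comul (X.lAct a x) = X.tensorL X a (comul x)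
  comul_r : ∀ (a : A) (x : C), comul (X.rAct a x) = X.tensorR X a (comul x)
  /-- the counit -/
  counit : C →ₗ[k] A
  counit_l : ∀ (a : A) (x : C), counit (X.lAct a x) = a * counit x
  counit_r : ∀ (a : A) (x : C), counit (X.rAct a x) = counit x * a
  coassoc : ∀ x : C,
    X.assoc X X (X.mapL comul comul_r (comul x)) = X.mapR comul comul_l (comul x)
  /-- `ε(x₍₁₎) · x₍₂₎ = x` -/
  counit_comul : ∀ x : C, X.contractL counit counit_r (comul x) = x
  /-- `x₍₁₎ · ε(x₍₂₎) = x` -/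
  comul_counit : ∀ x : C, X.contractR counit counit_l (comul x) = x

/-! ### `Aᵉ`-rings and bialgebroids -/

/-- An `Aᵉ`-ring structure on the `k`-algebra `U`, `Aᵉ = A ⊗ Aᵒᵖ`, given by its source and target
maps: `k`-algebra maps `A → U` and `Aᵒᵖ → U` with commuting images. -/
structure AeRing (k : Type u) (A : Type v) (U : Type w) [CommRing k] [Ring A] [Algebra k A]
    [Ring U] [Algebra k U] where
  /-- the source map -/
  src : A →ₐ[k] U
  /-- the target map -/
  tgt : Aᵐᵒᵖ →ₐ[k] U
  comm : ∀ a b, src a * tgt b = tgt b * src a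

namespace AeRing

variable {k : Type u} {A : Type v} [CommRing k] [Ring A] [Algebra k A]
variable {U : Type w} [Ring U] [Algebra k U] {W : Type w'} [Ring W] [Algebra k W]

/-- The bimodule `▷U◁`: `a ▷ u ◁ b = s(a) t(b) u`. -/
def leftBimod (E : AeRing k A U) : Bimod k A U where
  l := (Algebra.lmul k U).comp E.src
  r := (Algebra.lmul k U).comp E.tgt
  comm a b x := by simp [← mul_assoc, E.comm]

/-- The bimodule `▸U◂`: `a ▸ u ◂ b = u t(a) s(b)`. -/
def rightBimod (E : AeRing k A U) : Bimod k A U where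
  l := AlgHom.ofLinearMap
    ((LinearMap.mul k U).flip ∘ₗ E.tgt.toLinearMap ∘ₗ (opLinearEquiv k).toLinearMap)
    (by ext; simp) (by intros; ext; simp [mul_assoc])
  r := AlgHom.ofLinearMap
    ((LinearMap.mul k U).flip ∘ₗ E.src.toLinearMap ∘ₗ (opLinearEquiv k).symm.toLinearMap)
    (by ext; simp) (by intros; ext; simp [mul_assoc])
  comm a b x := by simp [mul_assoc, E.comm]

@[simp] theorem leftBimod_l (E : AeRing k A U) (a : A) (x : U) :
    E.leftBimod.l a x = E.src a * x := rfl
@[simp] theorem leftBimod_r (E : AeRing k A U) (a : Aᵐᵒᵖ) (x : U) :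
    E.leftBimod.r a x = E.tgt a * x := rfl
@[simp] theorem rightBimod_l (E : AeRing k A U) (a : A) (x : U) :
    E.rightBimod.l a x = x * E.tgt (op a) := rfl
@[simp] theorem rightBimod_r (E : AeRing k A U) (a : Aᵐᵒᵖ) (x : U) :
    E.rightBimod.r a x = x * E.src (unop a) := rfl

/-- The tensor product `U◁ ⊗_A ▷U`, in which `t(a) u ⊗ v = u ⊗ s(a) v`. -/
abbrev LTensor (E : AeRing k A U) := E.leftBimod.Tensor E.leftBimod

/-- The tensor product `U◂ ⊗_A ▸U`, in which `u s(a) ⊗ v = u ⊗ v t(a)`. -/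
abbrev RTensor (E : AeRing k A U) := E.rightBimod.Tensor E.rightBimod

theorem mulRight_rAct (E : AeRing k A U) (v : U) (a : A) (x : U) :
    LinearMap.mulRight k v (E.leftBimod.rAct a x) =
      E.leftBimod.rAct a (LinearMap.mulRight k v x) := by
  simp [Bimod.rAct_apply, mul_assoc]

theorem mulRight_lAct (E : AeRing k A U) (v : U) (a : A) (x : U) :
    LinearMap.mulRight k v (E.leftBimod.lAct a x) =
      E.leftBimod.lAct a (LinearMap.mulRight k v x) := by
  simp [Bimod.lAct_apply, mul_assoc]

theorem mulLeft_rAct (E : AeRing k A U) (v : U) (a : A) (x : U) :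
    LinearMap.mulLeft k v (E.rightBimod.rAct a x) =
      E.rightBimod.rAct a (LinearMap.mulLeft k v x) := by
  simp [Bimod.rAct_apply, mul_assoc]

theorem mulLeft_lAct (E : AeRing k A U) (v : U) (a : A) (x : U) :
    LinearMap.mulLeft k v (E.rightBimod.lAct a x) =
      E.rightBimod.lAct a (LinearMap.mulLeft k v x) := by
  simp [Bimod.lAct_apply, mul_assoc]

/-- `x ⊗ y ↦ x v ⊗ y v'` on `U◁ ⊗_A ▷U`. -/
def rmul (E : AeRing k A U) (v v' : U) : E.LTensor →ₗ[k] E.LTensor :=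
  BalTensor.map (LinearMap.mulRight k v) (LinearMap.mulRight k v') (E.mulRight_rAct v) (E.mulRight_lAct v')

/-- `x ⊗ y ↦ v x ⊗ v' y` on `U◂ ⊗_A ▸U`. -/
def lmul (E : AeRing k A U) (v v' : U) : E.RTensor →ₗ[k] E.RTensor :=
  BalTensor.map (LinearMap.mulLeft k v) (LinearMap.mulLeft k v') (E.mulLeft_rAct v) (E.mulLeft_lAct v')

@[simp] theorem rmul_tmul (E : AeRing k A U) (v v' x y : U) :
    E.rmul v v' (BalTensor.tmul _ _ x y) = BalTensor.tmul _ _ (x * v) (y * v') := by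
  simp [rmul]

@[simp] theorem lmul_tmul (E : AeRing k A U) (v v' x y : U) :
    E.lmul v v' (BalTensor.tmul _ _ x y) = BalTensor.tmul _ _ (v * x) (v' * y) := by
  simp [lmul]

/-- `rmul` as a bilinear map in `(v, v')`. -/
def rmulBilin (E : AeRing k A U) : U →ₗ[k] U →ₗ[k] Module.End k E.LTensor :=
  LinearMap.mk₂ k E.rmul
    (by intros; apply BalTensor.ext; simp [mul_add, BalTensor.add_tmul])
    (by intros; apply BalTensor.ext; simp [BalTensor.smul_tmul'])
    (by intros; apply BalTensor.ext; simp [mul_add, BalTensor.tmul_add])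
    (by intros; apply BalTensor.ext; simp [BalTensor.tmul_smul])

theorem rmul_rmul (E : AeRing k A U) (v v' w w' : U) (z : E.LTensor) :
    E.rmul w w' (E.rmul v v' z) = E.rmul (v * w) (v' * w') z := by
  induction z using BalTensor.induction with
  | h0 => simp
  | ha y z hy hz => simp only [map_add, hy, hz]
  | ht x y => simp [mul_assoc]

theorem rmul_add_right (E : AeRing k A U) (w v v' : U) (z : E.LTensor) :
    E.rmul w (v + v') z = E.rmul w v z + E.rmul w v' z :=
  LinearMap.congr_fun ((E.rmulBilin w).map_add v v') z

theorem rmul_smul_right (E : AeRing k A U) (c : k) (w v : U)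
    (z : E.LTensor) : E.rmul w (c • v) z = c • E.rmul w v z :=
  LinearMap.congr_fun ((E.rmulBilin w).map_smul c v) z

theorem rmul_add_left (E : AeRing k A U) (w v v' : U) (z : E.LTensor) :
    E.rmul (v + v') w z = E.rmul v w z + E.rmul v' w z :=
  LinearMap.congr_fun (E.rmulBilin.map_add₂ v v' w) z

theorem rmul_smul_left (E : AeRing k A U) (c : k) (w v : U)
    (z : E.LTensor) : E.rmul (c • v) w z = c • E.rmul v w z :=
  LinearMap.congr_fun (E.rmulBilin.map_smul₂ c v w) z

/-- `▸U ⊗_{Aᵒᵖ} U◁`, in which `u t(a) ⊗ v = u ⊗ t(a) v`. -/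
abbrev OpTensor (E : AeRing k A U) :=
  BalTensor E.rightBimod.lAct E.leftBimod.rAct

/-- `U◂ ⊗^A ▷U`, in which `u s(a) ⊗ v = u ⊗ s(a) v`. -/
abbrev UpTensor (E : AeRing k A U) :=
  BalTensor E.rightBimod.rAct E.leftBimod.lAct

/-- `lmul` as a bilinear map in `(v, v')`. -/
def lmulBilin (E : AeRing k A U) : U →ₗ[k] U →ₗ[k] Module.End k E.RTensor :=
  LinearMap.mk₂ k E.lmul
    (by intros; apply BalTensor.ext; simp [add_mul, BalTensor.add_tmul])
    (by intros; apply BalTensor.ext; simp [BalTensor.smul_tmul'])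
    (by intros; apply BalTensor.ext; simp [add_mul, BalTensor.tmul_add])
    (by intros; apply BalTensor.ext; simp [BalTensor.tmul_smul])

/-- Membership in the left Takeuchi product `U◁ ×_A ▷U`:
`∑ xᵢ t(a) ⊗ yᵢ = ∑ xᵢ ⊗ yᵢ s(a)` for all `a`. -/
def IsLeftTakeuchi (E : AeRing k A U) (x : E.LTensor) : Prop :=
  ∀ a : A, E.rmul (E.tgt (op a)) 1 x = E.rmul 1 (E.src a) x

/-- Membership in the right Takeuchi product `U◂ ×_A ▸U`:
`∑ s(a) xᵢ ⊗ yᵢ = ∑ xᵢ ⊗ t(a) yᵢ` for all `a`. -/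
def IsRightTakeuchi (E : AeRing k A U) (x : E.RTensor) : Prop :=
  ∀ a : A, E.lmul (E.src a) 1 x = E.lmul 1 (E.tgt (op a)) x

/-- The factorwise product `y ↦ x y`, `(∑ xᵢ ⊗ xᵢ') (v ⊗ v') = ∑ xᵢ v ⊗ xᵢ' v'`, for `x` in the
left Takeuchi product. -/
def leftTakeuchiMul (E : AeRing k A U) (x : E.LTensor) (hx : E.IsLeftTakeuchi x) :
    E.LTensor →ₗ[k] E.LTensor :=
  BalTensor.lift (E.rmulBilin.compr₂ (LinearMap.applyₗ x)) (by
    intro a m n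
    have key : ∀ v v' w w' : U, E.rmul (v * w) (v' * w') x = E.rmul w w' (E.rmul v v' x) := by
      intro v v' w w'
      rw [← LinearMap.comp_apply]
      refine LinearMap.congr_fun (BalTensor.ext ?_) x
      simp [mul_assoc]
    have h := congrArg (E.rmul m n) (hx a)
    rw [← key, ← key] at h
    simpa [rmulBilin, Bimod.lAct_apply, Bimod.rAct_apply] using h)

/-- The factorwise product `x ↦ x y`, `(v ⊗ v') (∑ yᵢ ⊗ yᵢ') = ∑ v yᵢ ⊗ v' yᵢ'`, for `y` in the
right Takeuchi product. -/
def rightTakeuchiMul (E : AeRing k A U) (y : E.RTensor) (hy : E.IsRightTakeuchi y) :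
    E.RTensor →ₗ[k] E.RTensor :=
  BalTensor.lift (E.lmulBilin.compr₂ (LinearMap.applyₗ y)) (by
    intro a m n
    have key : ∀ v v' w w' : U, E.lmul (v * w) (v' * w') y = E.lmul v v' (E.lmul w w' y) := by
      intro v v' w w'
      rw [← LinearMap.comp_apply]
      refine LinearMap.congr_fun (BalTensor.ext ?_) y
      simp [mul_assoc]
    have h := congrArg (E.lmul m n) (hy a)
    rw [← key, ← key] at h
    simpa [lmulBilin, Bimod.lAct_apply, Bimod.rAct_apply] using h)

/-- A `k`-linear map `F` is a morphism of `Aᵉ`-rings. -/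
structure IsHom (E : AeRing k A U) (E' : AeRing k A W) (F : U →ₗ[k] W) : Prop where
  map_one : F 1 = 1
  map_mul : ∀ x y, F (x * y) = F x * F y
  map_src : ∀ a, F (E.src a) = E'.src a
  map_tgt : ∀ a, F (E.tgt a) = E'.tgt a

/-- `▷U` is finitely generated projective over `A`, for the left action `a ▷ u = s(a) u`. -/
def FGProjSrc (E : AeRing k A U) : Prop :=
  letI : Module A U := Module.compHom U E.src.toRingHom
  Module.Finite A U ∧ Module.Projective A U

/-- `U◁` is finitely generated projective over `A`, for the right action `u ◁ a = t(a) u`. -/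
def FGProjTgt (E : AeRing k A U) : Prop :=
  letI : Module Aᵐᵒᵖ U := Module.compHom U E.tgt.toRingHom
  Module.Finite Aᵐᵒᵖ U ∧ Module.Projective Aᵐᵒᵖ U

end AeRing

namespace AeRing

variable {k : Type u} {A : Type v} [CommRing k] [Ring A] [Algebra k A]
variable {U : Type w} [Ring U] [Algebra k U] {W : Type w'} [Ring W] [Algebra k W]
variable {E : AeRing k A U} {E' : AeRing k A W} {F : U →ₗ[k] W}

theorem IsHom.map_rAct (h : E.IsHom E' F) (a : A) (x : U) :
    F (E.rightBimod.rAct a x) = E'.rightBimod.rAct a (F x) := by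
  simp [Bimod.rAct_apply, h.map_mul, h.map_src]

theorem IsHom.map_lAct (h : E.IsHom E' F) (a : A) (x : U) :
    F (E.rightBimod.lAct a x) = E'.rightBimod.lAct a (F x) := by
  simp [Bimod.lAct_apply, h.map_mul, h.map_tgt]

/-- The map `F ⊗_A F : U◂ ⊗_A ▸U → W◂ ⊗_A ▸W` for a morphism `F` of `Aᵉ`-rings. -/
def IsHom.rtensor (h : E.IsHom E' F) : E.RTensor →ₗ[k] E'.RTensor :=
  BalTensor.map F F h.map_rAct h.map_lAct

end AeRing

/-- A left bialgebroid structure over `A` on the `Aᵉ`-ring `(U, s, t)`. -/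
@[ext]
structure LeftBialgebroid {k : Type u} {A : Type v} {U : Type w} [CommRing k] [Ring A]
    [Algebra k A] [Ring U] [Algebra k U] (E : AeRing k A U) extends ACoring E.leftBimod where
  comul_takeuchi : ∀ u, E.IsLeftTakeuchi (comul u)
  comul_one : comul 1 = BalTensor.tmul _ _ 1 1
  comul_mul : ∀ u v, comul (u * v) = E.leftTakeuchiMul (comul u) (comul_takeuchi u) (comul v)
  counit_one : counit 1 = 1
  counit_mul_src : ∀ u v, counit (u * v) = counit (u * E.src (counit v))
  counit_mul_tgt : ∀ u v, counit (u * v) = counit (u * E.tgt (op (counit v)))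

/-- A right bialgebroid structure over `A` on the `Aᵉ`-ring `(W, s, t)`. -/
@[ext]
structure RightBialgebroid {k : Type u} {A : Type v} {W : Type w} [CommRing k] [Ring A]
    [Algebra k A] [Ring W] [Algebra k W] (E : AeRing k A W) extends ACoring E.rightBimod where
  comul_takeuchi : ∀ x, E.IsRightTakeuchi (comul x)
  comul_one : comul 1 = BalTensor.tmul _ _ 1 1
  comul_mul : ∀ x y, comul (x * y) = E.rightTakeuchiMul (comul y) (comul_takeuchi y) (comul x)
  counit_one : counit 1 = 1
  counit_src_mul : ∀ x y, counit (x * y) = counit (E.src (counit x) * y)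
  counit_tgt_mul : ∀ x y, counit (x * y) = counit (E.tgt (op (counit x)) * y)

/-- `(F, id_A)` is a morphism of right bialgebroids: `F` is a morphism of `Aᵉ`-rings compatible
with the counits and with the coproducts, `Δ (F x) = (F ⊗_A F) (Δ x)`. -/
structure RightBialgebroid.IsHom {k : Type u} {A : Type v} {W : Type w} {W' : Type w'} [CommRing k]
    [Ring A] [Algebra k A] [Ring W] [Algebra k W] [Ring W'] [Algebra k W'] {E : AeRing k A W}
    {E' : AeRing k A W'} (R : RightBialgebroid E) (R' : RightBialgebroid E')
    (F : W →ₗ[k] W') : Prop extends E.IsHom E' F where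
  map_counit : ∀ x, R'.counit (F x) = R.counit x
  map_comul : ∀ x, R'.comul (F x) = toIsHom.rtensor (R.comul x)

/-! ### The two duals of a left bialgebroid, as `Aᵉ`-rings with augmentation -/

namespace LeftBialgebroid

variable {k : Type u} {A : Type v} {U : Type w} [CommRing k] [Ring A] [Algebra k A]
  [Ring U] [Algebra k U] {E : AeRing k A U}

theorem counit_src_mul (B : LeftBialgebroid E) (a : A) (u : U) :
    B.counit (E.src a * u) = a * B.counit u := B.counit_l a u

theorem counit_tgt_mul (B : LeftBialgebroid E) (a : A) (u : U) :
    B.counit (E.tgt (op a) * u) = B.counit u * a := B.counit_r a u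

theorem counit_src (B : LeftBialgebroid E) (a : A) : B.counit (E.src a) = a := by
  simpa [B.counit_one] using B.counit_src_mul a 1

theorem counit_mul_tgt' (B : LeftBialgebroid E) (u : U) (a : A) :
    B.counit (u * E.tgt (op a)) = B.counit (u * E.src a) := by
  rw [B.counit_mul_tgt u (E.src a), counit_src]

theorem comul_src_mul (B : LeftBialgebroid E) (a : A) (u : U) :
    B.comul (E.src a * u) = E.leftBimod.tensorL E.leftBimod a (B.comul u) := B.comul_l a u

theorem comul_tgt_mul (B : LeftBialgebroid E) (a : A) (u : U) :
    B.comul (E.tgt (op a) * u) = E.leftBimod.tensorR E.leftBimod a (B.comul u) := B.comul_r a u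

theorem comul_mul_src (B : LeftBialgebroid E) (u : U) (a : A) :
    B.comul (u * E.src a) = E.rmul (E.src a) 1 (B.comul u) := by
  have h : B.comul (E.src a) = BalTensor.tmul _ _ (E.src a) 1 := by
    rw [← mul_one (E.src a), comul_src_mul, comul_one]; simp [Bimod.lAct_apply]
  rw [comul_mul, h]
  exact BalTensor.lift_tmul _ _ _ _

theorem comul_mul_tgt (B : LeftBialgebroid E) (u : U) (a : A) :
    B.comul (u * E.tgt (op a)) = E.rmul 1 (E.tgt (op a)) (B.comul u) := by
  have h : B.comul (E.tgt (op a)) = BalTensor.tmul _ _ 1 (E.tgt (op a)) := by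
    rw [← mul_one (E.tgt (op a)), comul_tgt_mul, comul_one]; simp [Bimod.rAct_apply]
  rw [comul_mul, h]
  exact BalTensor.lift_tmul _ _ _ _

/-- The right dual `U^* = Hom_{Aᵒᵖ}(U◁, A)`: the `φ : U → A` with `φ(u ◁ a) = φ(u) a`. -/
def RightDual (_B : LeftBialgebroid E) : Type (max v w) :=
  ↥({ carrier := {φ | ∀ (a : A) (u : U), φ (E.tgt (op a) * u) = φ u * a}
      add_mem' := fun h h' a u => by simp [h a u, h' a u, add_mul]
      zero_mem' := fun a u => by simp
      smul_mem' := fun c _ h a u => by simp [h a u] } : Submodule k (U →ₗ[k] A))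

/-- The left dual `U_* = Hom_A(▷U, A)`: the `ψ : U → A` with `ψ(a ▷ u) = a ψ(u)`. -/
def LeftDual (_B : LeftBialgebroid E) : Type (max v w) :=
  ↥({ carrier := {ψ | ∀ (a : A) (u : U), ψ (E.src a * u) = a * ψ u}
      add_mem' := fun h h' a u => by simp [h a u, h' a u, mul_add]
      zero_mem' := fun a u => by simp
      smul_mem' := fun c _ h a u => by simp [h a u] } : Submodule k (U →ₗ[k] A))

instance (B : LeftBialgebroid E) : AddCommGroup B.RightDual :=
  inferInstanceAs (AddCommGroup (Submodule.mk _ _ : Submodule k (U →ₗ[k] A)))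

instance (B : LeftBialgebroid E) : Module k B.RightDual :=
  inferInstanceAs (Module k (Submodule.mk _ _ : Submodule k (U →ₗ[k] A)))

instance (B : LeftBialgebroid E) : AddCommGroup B.LeftDual :=
  inferInstanceAs (AddCommGroup (Submodule.mk _ _ : Submodule k (U →ₗ[k] A)))

instance (B : LeftBialgebroid E) : Module k B.LeftDual :=
  inferInstanceAs (Module k (Submodule.mk _ _ : Submodule k (U →ₗ[k] A)))

/-- The inclusion `U^* → Hom_k(U, A)`; `B.evR φ u` is `φ(u)`. -/
def evR (B : LeftBialgebroid E) : B.RightDual →ₗ[k] (U →ₗ[k] A) :=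
  Submodule.subtype _

/-- The inclusion `U_* → Hom_k(U, A)`; `B.evL ψ u` is `ψ(u)`. -/
def evL (B : LeftBialgebroid E) : B.LeftDual →ₗ[k] (U →ₗ[k] A) :=
  Submodule.subtype _

/-- The element of `U^*` given by a right `A`-linear map. -/
def mkR (B : LeftBialgebroid E) (f : U →ₗ[k] A) (hf : ∀ a u, f (E.tgt (op a) * u) = f u * a) :
    B.RightDual := ⟨f, hf⟩

/-- The element of `U_*` given by a left `A`-linear map. -/
def mkL (B : LeftBialgebroid E) (f : U →ₗ[k] A) (hf : ∀ a u, f (E.src a * u) = a * f u) :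
    B.LeftDual := ⟨f, hf⟩

@[simp] theorem evR_mkR (B : LeftBialgebroid E) (f : U →ₗ[k] A) (hf) : B.evR (B.mkR f hf) = f := rfl

@[simp] theorem evL_mkL (B : LeftBialgebroid E) (f : U →ₗ[k] A) (hf) : B.evL (B.mkL f hf) = f := rfl

theorem evR_tgt_mul (B : LeftBialgebroid E) (φ : B.RightDual) (a : A) (u : U) :
    B.evR φ (E.tgt (op a) * u) = B.evR φ u * a := φ.2 a u

theorem evL_src_mul (B : LeftBialgebroid E) (ψ : B.LeftDual) (a : A) (u : U) :
    B.evL ψ (E.src a * u) = a * B.evL ψ u := ψ.2 a u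

theorem RightDual.ext (B : LeftBialgebroid E) {φ φ' : B.RightDual}
    (h : ∀ u, B.evR φ u = B.evR φ' u) : φ = φ' :=
  Subtype.ext (LinearMap.ext h)

theorem LeftDual.ext (B : LeftBialgebroid E) {ψ ψ' : B.LeftDual}
    (h : ∀ u, B.evL ψ u = B.evL ψ' u) : ψ = ψ' :=
  Subtype.ext (LinearMap.ext h)

/-- The map `U◁ ⊗_A ▷U → A`, `x ⊗ y ↦ f(s(φ(x)) y)`, for `φ ∈ U^*`. -/
def convR (B : LeftBialgebroid E) (φ : B.RightDual) (f : U →ₗ[k] A) : E.LTensor →ₗ[k] A :=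
  BalTensor.lift
    (LinearMap.mk₂ k (fun x y => f (E.src (B.evR φ x) * y))
      (by intros; simp [add_mul]) (by intros; simp) (by intros; simp [mul_add]) (by intros; simp))
    (by intros; simp [Bimod.rAct_apply, Bimod.lAct_apply, evR_tgt_mul, mul_assoc])

/-- The map `U◁ ⊗_A ▷U → A`, `x ⊗ y ↦ f(t(ψ(y)) x)`, for `ψ ∈ U_*`. -/
def convL (B : LeftBialgebroid E) (ψ : B.LeftDual) (f : U →ₗ[k] A) : E.LTensor →ₗ[k] A :=
  BalTensor.lift
    (LinearMap.mk₂ k (fun x y => f (E.tgt (op (B.evL ψ y)) * x))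
      (by intros; simp [mul_add]) (by intros; simp) (by intros; simp [add_mul]) (by intros; simp))
    (by intros; simp [Bimod.rAct_apply, Bimod.lAct_apply, evL_src_mul, mul_assoc])

@[simp] theorem convR_tmul (B : LeftBialgebroid E) (φ : B.RightDual) (f : U →ₗ[k] A) (x y : U) :
    B.convR φ f (BalTensor.tmul _ _ x y) = f (E.src (B.evR φ x) * y) :=
  BalTensor.lift_tmul _ _ _ _

@[simp] theorem convL_tmul (B : LeftBialgebroid E) (ψ : B.LeftDual) (f : U →ₗ[k] A) (x y : U) :
    B.convL ψ f (BalTensor.tmul _ _ x y) = f (E.tgt (op (B.evL ψ y)) * x) :=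
  BalTensor.lift_tmul _ _ _ _

/-- The product of `U^*`: `(φ φ')(u) = φ'(s(φ(u₍₁₎)) u₍₂₎)`. -/
instance (B : LeftBialgebroid E) : Mul B.RightDual where
  mul φ φ' := B.mkR (B.convR φ (B.evR φ') ∘ₗ B.comul) (by
    intro a u
    rw [LinearMap.comp_apply, comul_tgt_mul, LinearMap.comp_apply]
    induction B.comul u using BalTensor.induction with
    | h0 => simp
    | ha y z hy hz => simp only [map_add, add_mul, hy, hz]
    | ht x y =>
      simp only [Bimod.tensorR_tmul, convR_tmul, Bimod.rAct_apply, AeRing.leftBimod_r]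
      rw [← mul_assoc, E.comm, mul_assoc, evR_tgt_mul])

/-- The product of `U_*`: `(ψ ψ')(u) = ψ'(t(ψ(u₍₂₎)) u₍₁₎)`. -/
instance (B : LeftBialgebroid E) : Mul B.LeftDual where
  mul ψ ψ' := B.mkL (B.convL ψ (B.evL ψ') ∘ₗ B.comul) (by
    intro a u
    rw [LinearMap.comp_apply, comul_src_mul, LinearMap.comp_apply]
    induction B.comul u using BalTensor.induction with
    | h0 => simp
    | ha y z hy hz => simp only [map_add, mul_add, hy, hz]
    | ht x y =>
      simp only [Bimod.tensorL_tmul, convL_tmul, Bimod.lAct_apply, AeRing.leftBimod_l]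
      rw [← mul_assoc, ← E.comm, mul_assoc, evL_src_mul])

/-- The unit of `U^*` is the counit of `U`. -/
instance (B : LeftBialgebroid E) : One B.RightDual where
  one := B.mkR B.counit B.counit_tgt_mul

/-- The unit of `U_*` is the counit of `U`. -/
instance (B : LeftBialgebroid E) : One B.LeftDual where
  one := B.mkL B.counit B.counit_src_mul

theorem evR_mul (B : LeftBialgebroid E) (φ φ' : B.RightDual) (u : U) :
    B.evR (φ * φ') u = B.convR φ (B.evR φ') (B.comul u) := rfl

theorem evL_mul (B : LeftBialgebroid E) (ψ ψ' : B.LeftDual) (u : U) :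
    B.evL (ψ * ψ') u = B.convL ψ (B.evL ψ') (B.comul u) := rfl

@[simp] theorem evR_one (B : LeftBialgebroid E) : B.evR 1 = B.counit := rfl

@[simp] theorem evL_one (B : LeftBialgebroid E) : B.evL 1 = B.counit := rfl

theorem convR_add_left (B : LeftBialgebroid E) (φ φ' : B.RightDual) (f : U →ₗ[k] A)
    (z : E.LTensor) : B.convR (φ + φ') f z = B.convR φ f z + B.convR φ' f z :=
  LinearMap.congr_fun (f := B.convR (φ + φ') f) (g := B.convR φ f + B.convR φ' f)
    (BalTensor.ext (by intros; simp [add_mul])) z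

theorem convR_add_right (B : LeftBialgebroid E) (φ : B.RightDual) (f f' : U →ₗ[k] A)
    (z : E.LTensor) : B.convR φ (f + f') z = B.convR φ f z + B.convR φ f' z :=
  LinearMap.congr_fun (f := B.convR φ (f + f')) (g := B.convR φ f + B.convR φ f')
    (BalTensor.ext (by intros; simp)) z

theorem convR_smul_left (B : LeftBialgebroid E) (c : k) (φ : B.RightDual) (f : U →ₗ[k] A)
    (z : E.LTensor) : B.convR (c • φ) f z = c • B.convR φ f z :=
  LinearMap.congr_fun (f := B.convR (c • φ) f) (g := c • B.convR φ f)
    (BalTensor.ext (by intros; simp)) z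

theorem convR_smul_right (B : LeftBialgebroid E) (c : k) (φ : B.RightDual) (f : U →ₗ[k] A)
    (z : E.LTensor) : B.convR φ (c • f) z = c • B.convR φ f z :=
  LinearMap.congr_fun (f := B.convR φ (c • f)) (g := c • B.convR φ f)
    (BalTensor.ext (by intros; simp)) z

theorem convL_add_left (B : LeftBialgebroid E) (ψ ψ' : B.LeftDual) (f : U →ₗ[k] A)
    (z : E.LTensor) : B.convL (ψ + ψ') f z = B.convL ψ f z + B.convL ψ' f z :=
  LinearMap.congr_fun (f := B.convL (ψ + ψ') f) (g := B.convL ψ f + B.convL ψ' f)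
    (BalTensor.ext (by intros; simp [add_mul])) z

theorem convL_add_right (B : LeftBialgebroid E) (ψ : B.LeftDual) (f f' : U →ₗ[k] A)
    (z : E.LTensor) : B.convL ψ (f + f') z = B.convL ψ f z + B.convL ψ f' z :=
  LinearMap.congr_fun (f := B.convL ψ (f + f')) (g := B.convL ψ f + B.convL ψ f')
    (BalTensor.ext (by intros; simp)) z

theorem convL_smul_left (B : LeftBialgebroid E) (c : k) (ψ : B.LeftDual) (f : U →ₗ[k] A)
    (z : E.LTensor) : B.convL (c • ψ) f z = c • B.convL ψ f z :=
  LinearMap.congr_fun (f := B.convL (c • ψ) f) (g := c • B.convL ψ f)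
    (BalTensor.ext (by intros; simp)) z

theorem convL_smul_right (B : LeftBialgebroid E) (c : k) (ψ : B.LeftDual) (f : U →ₗ[k] A)
    (z : E.LTensor) : B.convL ψ (c • f) z = c • B.convL ψ f z :=
  LinearMap.congr_fun (f := B.convL ψ (c • f)) (g := c • B.convL ψ f)
    (BalTensor.ext (by intros; simp)) z

theorem RightDual.one_mul' (B : LeftBialgebroid E) (φ : B.RightDual) : 1 * φ = φ := by
  refine RightDual.ext B fun u => ?_
  conv_rhs => rw [← B.counit_comul u]
  rw [evR_mul]
  induction B.comul u using BalTensor.induction with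
  | h0 => simp
  | ha y z hy hz => simp only [map_add, hy, hz]
  | ht x y => simp [Bimod.lAct_apply]

theorem RightDual.mul_one' (B : LeftBialgebroid E) (φ : B.RightDual) : φ * 1 = φ := by
  refine RightDual.ext B fun u => ?_
  conv_rhs => rw [← B.comul_counit u]
  rw [evR_mul]
  induction B.comul u using BalTensor.induction with
  | h0 => simp
  | ha y z hy hz => simp only [map_add, hy, hz]
  | ht x y => simp [Bimod.rAct_apply, counit_src_mul, evR_tgt_mul]

theorem LeftDual.one_mul' (B : LeftBialgebroid E) (ψ : B.LeftDual) : 1 * ψ = ψ := by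
  refine LeftDual.ext B fun u => ?_
  conv_rhs => rw [← B.comul_counit u]
  rw [evL_mul]
  induction B.comul u using BalTensor.induction with
  | h0 => simp
  | ha y z hy hz => simp only [map_add, hy, hz]
  | ht x y => simp [Bimod.rAct_apply]

theorem LeftDual.mul_one' (B : LeftBialgebroid E) (ψ : B.LeftDual) : ψ * 1 = ψ := by
  refine LeftDual.ext B fun u => ?_
  conv_rhs => rw [← B.counit_comul u]
  rw [evL_mul]
  induction B.comul u using BalTensor.induction with
  | h0 => simp
  | ha y z hy hz => simp only [map_add, hy, hz]
  | ht x y => simp [Bimod.lAct_apply, counit_tgt_mul, evL_src_mul]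

theorem RightDual.mul_assoc' (B : LeftBialgebroid E) (φ φ' φ'' : B.RightDual) :
    φ * φ' * φ'' = φ * (φ' * φ'') := by
  refine RightDual.ext B fun u => ?_
  have hc : ∀ (a : A) (x : U), B.convR φ' (B.evR φ'') (E.leftBimod.tensorL E.leftBimod a
      (B.comul x)) = (B.evR (φ' * φ'')) (E.src a * x) := by
    intro a x; rw [evR_mul, comul_src_mul]
  -- the trilinear map `x ⊗ (y ⊗ z) ↦ φ''(s(φ'(s(φ(x)) y)) z)`
  let G : BalTensor E.leftBimod.rAct (E.leftBimod.tensorL E.leftBimod) →ₗ[k] A :=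
    BalTensor.lift
      (LinearMap.mk₂ k (fun x z => B.convR φ' (B.evR φ'')
          (E.leftBimod.tensorL E.leftBimod (B.evR φ x) z))
        (by
          intro x x' z
          induction z using BalTensor.induction with
          | h0 => simp
          | ha y z hy hz => simp only [map_add] at hy hz ⊢; rw [hy, hz]; abel
          | ht y z => simp [Bimod.lAct_apply, add_mul])
        (by
          intro c x z
          induction z using BalTensor.induction with
          | h0 => simp
          | ha y z hy hz => simp only [map_add, hy, hz, smul_add]
          | ht y z => simp [Bimod.lAct_apply])
        (by intros; simp) (by intros; simp))
      (by
        intro a x z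
        induction z using BalTensor.induction with
        | h0 => simp
        | ha y z hy hz => simp only [map_add, hy, hz]
        | ht y z =>
          simp [Bimod.lAct_apply, Bimod.rAct_apply, evR_tgt_mul])
  have hG : ∀ x z, G (BalTensor.tmul _ _ x z) = B.convR φ' (B.evR φ'')
      (E.leftBimod.tensorL E.leftBimod (B.evR φ x) z) := fun x z => BalTensor.lift_tmul _ _ _ _
  have h := congrArg G (B.coassoc u)
  have h1 : G (E.leftBimod.mapR B.comul B.comul_l (B.comul u)) = B.evR (φ * (φ' * φ'')) u := by
    rw [evR_mul]
    induction B.comul u using BalTensor.induction with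
    | h0 => simp
    | ha y z hy hz => simp only [map_add, hy, hz]
    | ht x y => rw [Bimod.mapR_tmul, hG, hc, convR_tmul]
  have h2 : G (E.leftBimod.assoc E.leftBimod E.leftBimod
      (E.leftBimod.mapL B.comul B.comul_r (B.comul u))) = B.evR (φ * φ' * φ'') u := by
    rw [evR_mul]
    induction B.comul u using BalTensor.induction with
    | h0 => simp
    | ha y z hy hz => simp only [map_add, hy, hz]
    | ht x y =>
      rw [Bimod.mapL_tmul, convR_tmul, evR_mul]
      induction B.comul x using BalTensor.induction with
      | h0 => rw [← BalTensor.mk_apply]; simp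
      | ha z z' hz hz' => simp only [map_add, add_mul, BalTensor.add_tmul, hz, hz']
      | ht z z' => rw [Bimod.assoc_tmul, hG]; simp [Bimod.lAct_apply]
  rw [← h1, ← h2, h]

theorem LeftDual.mul_assoc' (B : LeftBialgebroid E) (ψ ψ' ψ'' : B.LeftDual) :
    ψ * ψ' * ψ'' = ψ * (ψ' * ψ'') := by
  refine LeftDual.ext B fun u => ?_
  have hc : ∀ (a : A) (x : U), B.convL ψ' (B.evL ψ'') (E.leftBimod.tensorR E.leftBimod a
      (B.comul x)) = (B.evL (ψ' * ψ'')) (E.tgt (op a) * x) := by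
    intro a x; rw [evL_mul, comul_tgt_mul]
  -- the trilinear map `x ⊗ (y ⊗ z) ↦ ψ''(t(ψ'(t(ψ(z)) y)) x)`
  let G : BalTensor E.leftBimod.rAct (E.leftBimod.tensorL E.leftBimod) →ₗ[k] A :=
    BalTensor.lift
      (LinearMap.mk₂ k (fun x z => B.convL ψ (B.convL ψ' (B.evL ψ'') ∘ₗ
          BalTensor.mk E.leftBimod.rAct E.leftBimod.lAct x) z)
        (by
          intro x x' z
          rw [map_add, LinearMap.comp_add, convL_add_right])
        (by
          intro c x z
          rw [map_smul, LinearMap.comp_smul, convL_smul_right])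
        (by intros; simp) (by intros; simp))
      (by
        intro a x z
        induction z using BalTensor.induction with
        | h0 => simp
        | ha y z hy hz => simp only [map_add, hy, hz]
        | ht y z =>
          simp only [LinearMap.mk₂_apply, Bimod.tensorL_tmul, convL_tmul, LinearMap.comp_apply,
            BalTensor.mk_apply, Bimod.lAct_apply, Bimod.rAct_apply, AeRing.leftBimod_l,
            AeRing.leftBimod_r]
          conv_rhs => rw [← mul_assoc _ (E.src a) y, ← E.comm, mul_assoc, evL_src_mul]
          simp [mul_assoc])
  have hG : ∀ x z, G (BalTensor.tmul _ _ x z) = B.convL ψ (B.convL ψ' (B.evL ψ'') ∘ₗ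
          BalTensor.mk E.leftBimod.rAct E.leftBimod.lAct x) z :=
    fun x z => BalTensor.lift_tmul _ _ _ _
  have h := congrArg G (B.coassoc u)
  have h1 : G (E.leftBimod.mapR B.comul B.comul_l (B.comul u)) = B.evL (ψ * ψ' * ψ'') u := by
    rw [evL_mul]
    induction B.comul u using BalTensor.induction with
    | h0 => simp
    | ha y z hy hz => simp only [map_add, hy, hz]
    | ht x y =>
      rw [Bimod.mapR_tmul, hG, convL_tmul, evL_mul]
      induction B.comul y using BalTensor.induction with
      | h0 => simp
      | ha z z' hz hz' => simp only [map_add, op_add, add_mul, hz, hz']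
      | ht z z' => simp
  have h2 : G (E.leftBimod.assoc E.leftBimod E.leftBimod
      (E.leftBimod.mapL B.comul B.comul_r (B.comul u))) = B.evL (ψ * (ψ' * ψ'')) u := by
    rw [evL_mul]
    induction B.comul u using BalTensor.induction with
    | h0 => simp
    | ha y z hy hz => simp only [map_add, hy, hz]
    | ht x y =>
      rw [Bimod.mapL_tmul, convL_tmul, ← hc]
      induction B.comul x using BalTensor.induction with
      | h0 => rw [← BalTensor.mk_apply]; simp
      | ha z z' hz hz' => simp only [map_add, BalTensor.add_tmul, hz, hz']
      | ht z z' => rw [Bimod.assoc_tmul, hG]; simp [Bimod.rAct_apply]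
  rw [← h1, ← h2, h]

instance (B : LeftBialgebroid E) : Ring B.RightDual where
  __ := (inferInstance : AddCommGroup B.RightDual)
  mul_assoc := RightDual.mul_assoc' B
  one_mul := RightDual.one_mul' B
  mul_one := RightDual.mul_one' B
  zero_mul φ := RightDual.ext B fun u => by
    have h := B.convR_smul_left 0 0 (B.evR φ) (B.comul u)
    rw [zero_smul, zero_smul] at h
    rw [evR_mul, h]; simp
  mul_zero φ := RightDual.ext B fun u => by
    have h := B.convR_smul_right 0 φ 0 (B.comul u)
    rw [zero_smul, zero_smul] at h
    rw [evR_mul, map_zero, h]; simp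
  left_distrib φ φ' φ'' := RightDual.ext B fun u => by
    simp only [evR_mul, map_add, convR_add_right, LinearMap.add_apply]
  right_distrib φ φ' φ'' := RightDual.ext B fun u => by
    simp only [evR_mul, map_add, convR_add_left, LinearMap.add_apply]

instance (B : LeftBialgebroid E) : Ring B.LeftDual where
  __ := (inferInstance : AddCommGroup B.LeftDual)
  mul_assoc := LeftDual.mul_assoc' B
  one_mul := LeftDual.one_mul' B
  mul_one := LeftDual.mul_one' B
  zero_mul ψ := LeftDual.ext B fun u => by
    have h := B.convL_smul_left 0 0 (B.evL ψ) (B.comul u)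
    rw [zero_smul, zero_smul] at h
    rw [evL_mul, h]; simp
  mul_zero ψ := LeftDual.ext B fun u => by
    have h := B.convL_smul_right 0 ψ 0 (B.comul u)
    rw [zero_smul, zero_smul] at h
    rw [evL_mul, map_zero, h]; simp
  left_distrib ψ ψ' ψ'' := LeftDual.ext B fun u => by
    simp only [evL_mul, map_add, convL_add_right, LinearMap.add_apply]
  right_distrib ψ ψ' ψ'' := LeftDual.ext B fun u => by
    simp only [evL_mul, map_add, convL_add_left, LinearMap.add_apply]

instance (B : LeftBialgebroid E) : Algebra k B.RightDual :=
  Algebra.ofModule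
    (fun c φ φ' => RightDual.ext B fun u => by
      simp only [evR_mul, map_smul, convR_smul_left, LinearMap.smul_apply])
    (fun c φ φ' => RightDual.ext B fun u => by
      simp only [evR_mul, map_smul, convR_smul_right, LinearMap.smul_apply])

instance (B : LeftBialgebroid E) : Algebra k B.LeftDual :=
  Algebra.ofModule
    (fun c ψ ψ' => LeftDual.ext B fun u => by
      simp only [evL_mul, map_smul, convL_smul_left, LinearMap.smul_apply])
    (fun c ψ ψ' => LeftDual.ext B fun u => by
      simp only [evL_mul, map_smul, convL_smul_right, LinearMap.smul_apply])

/-- The source of `U^*`: `u ↦ ε(u s(a))`. -/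
def srcR (B : LeftBialgebroid E) (a : A) : B.RightDual :=
  B.mkR (B.counit ∘ₗ LinearMap.mulRight k (E.src a)) (by intros; simp [mul_assoc, counit_tgt_mul])

/-- The target of `U^*`: `u ↦ a ε(u)`. -/
def tgtR (B : LeftBialgebroid E) (a : A) : B.RightDual :=
  B.mkR (LinearMap.mulLeft k a ∘ₗ B.counit) (by intros; simp [mul_assoc, counit_tgt_mul])

/-- The source of `U_*`: `u ↦ ε(u) a`. -/
def srcL (B : LeftBialgebroid E) (a : A) : B.LeftDual :=
  B.mkL (LinearMap.mulRight k a ∘ₗ B.counit) (by intros; simp [mul_assoc, counit_src_mul])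

/-- The target of `U_*`: `u ↦ ε(u t(a))`. -/
def tgtL (B : LeftBialgebroid E) (a : A) : B.LeftDual :=
  B.mkL (B.counit ∘ₗ LinearMap.mulRight k (E.tgt (op a)))
    (by intros; simp [mul_assoc, counit_src_mul])

@[simp] theorem evR_srcR (B : LeftBialgebroid E) (a : A) (u : U) :
    B.evR (B.srcR a) u = B.counit (u * E.src a) := rfl
@[simp] theorem evR_tgtR (B : LeftBialgebroid E) (a : A) (u : U) :
    B.evR (B.tgtR a) u = a * B.counit u := rfl
@[simp] theorem evL_srcL (B : LeftBialgebroid E) (a : A) (u : U) :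
    B.evL (B.srcL a) u = B.counit u * a := rfl
@[simp] theorem evL_tgtL (B : LeftBialgebroid E) (a : A) (u : U) :
    B.evL (B.tgtL a) u = B.counit (u * E.tgt (op a)) := rfl

theorem evR_srcR_mul (B : LeftBialgebroid E) (a : A) (φ : B.RightDual) (u : U) :
    B.evR (B.srcR a * φ) u = B.evR φ (u * E.src a) := by
  conv_rhs => rw [← B.counit_comul (u * E.src a), comul_mul_src]
  rw [evR_mul]
  induction B.comul u using BalTensor.induction with
  | h0 => simp
  | ha y z hy hz => simp only [map_add, hy, hz]
  | ht x y => simp [Bimod.lAct_apply]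

theorem evR_tgtR_mul (B : LeftBialgebroid E) (a : A) (φ : B.RightDual) (u : U) :
    B.evR (B.tgtR a * φ) u = B.evR φ (E.src a * u) := by
  conv_rhs => rw [← B.counit_comul u]
  rw [evR_mul]
  induction B.comul u using BalTensor.induction with
  | h0 => simp
  | ha y z hy hz => simp only [map_add, mul_add, hy, hz]
  | ht x y => simp [Bimod.lAct_apply, mul_assoc]

theorem evR_mul_srcR (B : LeftBialgebroid E) (a : A) (φ : B.RightDual) (u : U) :
    B.evR (φ * B.srcR a) u = B.evR φ (u * E.tgt (op a)) := by
  conv_rhs => rw [← B.comul_counit (u * E.tgt (op a)), comul_mul_tgt]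
  have h : B.evR φ (E.leftBimod.contractR B.counit B.counit_l
      (E.rmul 1 (E.tgt (op a)) (B.comul u))) = B.convR φ B.counit
      (E.rmul 1 (E.tgt (op a)) (B.comul u)) := by
    generalize E.rmul 1 (E.tgt (op a)) (B.comul u) = z
    induction z using BalTensor.induction with
    | h0 => simp
    | ha y z hy hz => simp only [map_add, hy, hz]
    | ht x y => simp [Bimod.rAct_apply, counit_src_mul, evR_tgt_mul]
  rw [h, evR_mul]
  induction B.comul u using BalTensor.induction with
  | h0 => simp
  | ha y z hy hz => simp only [map_add, hy, hz]
  | ht x y =>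
    simp only [convR_tmul, AeRing.rmul_tmul, evR_srcR, mul_one]
    rw [← mul_assoc, counit_mul_tgt']

theorem evR_mul_tgtR (B : LeftBialgebroid E) (a : A) (φ : B.RightDual) (u : U) :
    B.evR (φ * B.tgtR a) u = a * B.evR φ u := by
  conv_rhs => rw [← RightDual.mul_one' B φ]
  rw [evR_mul, evR_mul]
  induction B.comul u using BalTensor.induction with
  | h0 => simp
  | ha y z hy hz => simp only [map_add, mul_add, hy, hz]
  | ht x y => simp

theorem evL_srcL_mul (B : LeftBialgebroid E) (a : A) (ψ : B.LeftDual) (u : U) :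
    B.evL (B.srcL a * ψ) u = B.evL ψ (E.tgt (op a) * u) := by
  conv_rhs => rw [← B.comul_counit u]
  rw [evL_mul]
  induction B.comul u using BalTensor.induction with
  | h0 => simp
  | ha y z hy hz => simp only [map_add, mul_add, hy, hz]
  | ht x y => simp [Bimod.rAct_apply, mul_assoc]

theorem evL_tgtL_mul (B : LeftBialgebroid E) (a : A) (ψ : B.LeftDual) (u : U) :
    B.evL (B.tgtL a * ψ) u = B.evL ψ (u * E.tgt (op a)) := by
  conv_rhs => rw [← B.comul_counit (u * E.tgt (op a)), comul_mul_tgt]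
  rw [evL_mul]
  induction B.comul u using BalTensor.induction with
  | h0 => simp
  | ha y z hy hz => simp only [map_add, hy, hz]
  | ht x y => simp [Bimod.rAct_apply]

theorem evL_mul_srcL (B : LeftBialgebroid E) (a : A) (ψ : B.LeftDual) (u : U) :
    B.evL (ψ * B.srcL a) u = B.evL ψ u * a := by
  conv_rhs => rw [← LeftDual.mul_one' B ψ]
  rw [evL_mul, evL_mul]
  induction B.comul u using BalTensor.induction with
  | h0 => simp
  | ha y z hy hz => simp only [map_add, add_mul, hy, hz]
  | ht x y => simp

theorem evL_mul_tgtL (B : LeftBialgebroid E) (a : A) (ψ : B.LeftDual) (u : U) :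
    B.evL (ψ * B.tgtL a) u = B.evL ψ (u * E.src a) := by
  conv_rhs => rw [← LeftDual.mul_one' B ψ]
  rw [evL_mul, evL_mul, comul_mul_src]
  induction B.comul u using BalTensor.induction with
  | h0 => simp
  | ha y z hy hz => simp only [map_add, hy, hz]
  | ht x y =>
    simp only [convL_tmul, AeRing.rmul_tmul, evL_tgtL, mul_one, evL_one]
    rw [← mul_assoc, counit_mul_tgt']

/-- The `Aᵉ`-ring structure of `U^*`. -/
def rightDualRing (B : LeftBialgebroid E) : AeRing k A B.RightDual where
  src :=
    { toFun := B.srcR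
      map_one' := RightDual.ext B fun u => by simp
      map_mul' := fun a b => RightDual.ext B fun u => by
        rw [evR_srcR_mul]; simp [mul_assoc]
      map_zero' := RightDual.ext B fun u => by simp
      map_add' := fun a b => RightDual.ext B fun u => by simp [mul_add]
      commutes' := fun c => RightDual.ext B fun u => by
        simp [Algebra.algebraMap_eq_smul_one] }
  tgt :=
    { toFun := fun a => B.tgtR (unop a)
      map_one' := RightDual.ext B fun u => by simp
      map_mul' := fun a b => RightDual.ext B fun u => by
        rw [evR_tgtR_mul]; simp [mul_assoc, counit_src_mul]
      map_zero' := RightDual.ext B fun u => by simp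
      map_add' := fun a b => RightDual.ext B fun u => by simp [add_mul]
      commutes' := fun c => RightDual.ext B fun u => by
        simp [Algebra.algebraMap_eq_smul_one] }
  comm a b := RightDual.ext B fun u => by
    change B.evR (B.srcR a * B.tgtR (unop b)) u = B.evR (B.tgtR (unop b) * B.srcR a) u
    rw [evR_srcR_mul, evR_tgtR_mul]; simp [mul_assoc, counit_src_mul]

/-- The `Aᵉ`-ring structure of `U_*`. -/
def leftDualRing (B : LeftBialgebroid E) : AeRing k A B.LeftDual where
  src :=
    { toFun := B.srcL
      map_one' := LeftDual.ext B fun u => by simp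
      map_mul' := fun a b => LeftDual.ext B fun u => by
        rw [evL_srcL_mul]; simp [mul_assoc, counit_tgt_mul]
      map_zero' := LeftDual.ext B fun u => by simp
      map_add' := fun a b => LeftDual.ext B fun u => by simp [mul_add]
      commutes' := fun c => LeftDual.ext B fun u => by
        simp [Algebra.algebraMap_eq_smul_one] }
  tgt :=
    { toFun := fun a => B.tgtL (unop a)
      map_one' := LeftDual.ext B fun u => by simp
      map_mul' := fun a b => LeftDual.ext B fun u => by
        rw [evL_tgtL_mul]; simp [mul_assoc]
      map_zero' := LeftDual.ext B fun u => by simp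
      map_add' := fun a b => LeftDual.ext B fun u => by simp [mul_add]
      commutes' := fun c => LeftDual.ext B fun u => by
        simp [Algebra.algebraMap_eq_smul_one] }
  comm a b := LeftDual.ext B fun u => by
    change B.evL (B.srcL a * B.tgtL (unop b)) u = B.evL (B.tgtL (unop b) * B.srcL a) u
    rw [evL_srcL_mul, evL_tgtL_mul]; simp [mul_assoc, counit_tgt_mul]

@[simp] theorem rightDualRing_src (B : LeftBialgebroid E) (a : A) :
    B.rightDualRing.src a = B.srcR a := rfl
@[simp] theorem rightDualRing_tgt (B : LeftBialgebroid E) (a : A) :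
    B.rightDualRing.tgt (op a) = B.tgtR a := rfl
@[simp] theorem leftDualRing_src (B : LeftBialgebroid E) (a : A) :
    B.leftDualRing.src a = B.srcL a := rfl
@[simp] theorem leftDualRing_tgt (B : LeftBialgebroid E) (a : A) :
    B.leftDualRing.tgt (op a) = B.tgtL a := rfl

/-- The pairing of `U ⊗ U` with `U^*◂ ⊗_A ▸U^*`, `(u, v; φ ⊗ φ') ↦ φ(u t(φ'(v)))`. -/
def pairR (B : LeftBialgebroid E) (u v : U) : B.rightDualRing.RTensor →ₗ[k] A :=
  BalTensor.lift
    (LinearMap.mk₂ k (fun φ φ' => B.evR φ (u * E.tgt (op (B.evR φ' v))))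
      (by intros; simp) (by intros; simp) (by intros; simp [mul_add]) (by intros; simp))
    (by intros; simp [Bimod.rAct_apply, Bimod.lAct_apply, evR_mul_srcR, evR_mul_tgtR, mul_assoc])

/-- The pairing of `U ⊗ U` with `U_*◂ ⊗_A ▸U_*`, `(u, v; ψ ⊗ ψ') ↦ ψ'(u s(ψ(v)))`. -/
def pairL (B : LeftBialgebroid E) (u v : U) : B.leftDualRing.RTensor →ₗ[k] A :=
  BalTensor.lift
    (LinearMap.mk₂ k (fun ψ ψ' => B.evL ψ' (u * E.src (B.evL ψ v)))
      (by intros; simp [mul_add]) (by intros; simp) (by intros; simp) (by intros; simp))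
    (by intros; simp [Bimod.rAct_apply, Bimod.lAct_apply, evL_mul_srcL, evL_mul_tgtL, mul_assoc])

/-- `R` is the right bialgebroid structure on the `Aᵉ`-ring `U^*` dual to `U`: its counit is
`φ ↦ φ(1)` and its coproduct is dual to the product of `U`, `φ(u v) = φ⁽¹⁾(u t(φ⁽²⁾(v)))`. -/
structure IsRightDual (B : LeftBialgebroid E) (R : RightBialgebroid B.rightDualRing) : Prop where
  counit_eq : ∀ φ, R.counit φ = B.evR φ 1
  comul_eq : ∀ φ u v, B.evR φ (u * v) = B.pairR u v (R.comul φ)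

/-- `R` is the right bialgebroid structure on the `Aᵉ`-ring `U_*` dual to `U`: its counit is
`ψ ↦ ψ(1)` and its coproduct is dual to the product of `U`, `ψ(u v) = ψ⁽²⁾(u s(ψ⁽¹⁾(v)))`. -/
structure IsLeftDual (B : LeftBialgebroid E) (R : RightBialgebroid B.leftDualRing) : Prop where
  counit_eq : ∀ ψ, R.counit ψ = B.evL ψ 1
  comul_eq : ∀ ψ u v, B.evL ψ (u * v) = B.pairL u v (R.comul ψ)

/-! ### Hopf–Galois maps and the maps between the duals -/

/-- The Hopf–Galois map `α_ℓ : ▸U ⊗_{Aᵒᵖ} U◁ → U◁ ⊗_A ▷U`, `u ⊗ v ↦ u₍₁₎ ⊗ u₍₂₎ v`. -/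
def galoisL (B : LeftBialgebroid E) : E.OpTensor →ₗ[k] E.LTensor :=
  BalTensor.lift
    (LinearMap.mk₂ k (fun u v => E.rmul 1 v (B.comul u))
      (by intros; simp) (by intros; simp)
      (fun _ _ _ => E.rmul_add_right _ _ _ _) (fun _ _ _ => E.rmul_smul_right _ _ _ _))
    (by intros; simp [Bimod.lAct_apply, Bimod.rAct_apply, comul_mul_tgt, AeRing.rmul_rmul])

/-- The Hopf–Galois map `α_r : U◂ ⊗^A ▷U → U◁ ⊗_A ▷U`, `u ⊗ v ↦ u₍₁₎ v ⊗ u₍₂₎`. -/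
def galoisR (B : LeftBialgebroid E) : E.UpTensor →ₗ[k] E.LTensor :=
  BalTensor.lift
    (LinearMap.mk₂ k (fun u v => E.rmul v 1 (B.comul u))
      (by intros; simp) (by intros; simp)
      (fun _ _ _ => E.rmul_add_left _ _ _ _) (fun _ _ _ => E.rmul_smul_left _ _ _ _))
    (by intros; simp [Bimod.lAct_apply, Bimod.rAct_apply, comul_mul_src, AeRing.rmul_rmul])

@[simp] theorem galoisL_tmul (B : LeftBialgebroid E) (u v : U) :
    B.galoisL (BalTensor.tmul _ _ u v) = E.rmul 1 v (B.comul u) :=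
  BalTensor.lift_tmul _ _ _ _

@[simp] theorem galoisR_tmul (B : LeftBialgebroid E) (u v : U) :
    B.galoisR (BalTensor.tmul _ _ u v) = E.rmul v 1 (B.comul u) :=
  BalTensor.lift_tmul _ _ _ _

/-- `U` is a left Hopf algebroid. -/
def IsLeftHopf (B : LeftBialgebroid E) : Prop := Function.Bijective B.galoisL

/-- `U` is a right Hopf algebroid. -/
def IsRightHopf (B : LeftBialgebroid E) : Prop := Function.Bijective B.galoisR

/-- The translation map `u ↦ u₊ ⊗ u₋ = α_ℓ⁻¹(u ⊗ 1)` of a left Hopf algebroid. -/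
noncomputable def transL (B : LeftBialgebroid E) (h : B.IsLeftHopf) : U →ₗ[k] E.OpTensor :=
  (LinearEquiv.ofBijective B.galoisL h).symm.toLinearMap ∘ₗ
    (BalTensor.mk E.leftBimod.rAct E.leftBimod.lAct).flip 1

/-- The translation map `u ↦ u₍₊₎ ⊗ u₍₋₎ = α_r⁻¹(1 ⊗ u)` of a right Hopf algebroid. -/
noncomputable def transR (B : LeftBialgebroid E) (h : B.IsRightHopf) : U →ₗ[k] E.UpTensor :=
  (LinearEquiv.ofBijective B.galoisR h).symm.toLinearMap ∘ₗ
    BalTensor.mk E.leftBimod.rAct E.leftBimod.lAct 1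

theorem galoisL_transL (B : LeftBialgebroid E) (h : B.IsLeftHopf) (u : U) :
    B.galoisL (B.transL h u) = BalTensor.tmul _ _ u 1 :=
  (LinearEquiv.ofBijective B.galoisL h).apply_symm_apply _

theorem galoisR_transR (B : LeftBialgebroid E) (h : B.IsRightHopf) (u : U) :
    B.galoisR (B.transR h u) = BalTensor.tmul _ _ 1 u :=
  (LinearEquiv.ofBijective B.galoisR h).apply_symm_apply _

/-- The map `▸U ⊗_{Aᵒᵖ} U◁ → A`, `x ⊗ y ↦ ε(x t(φ(y)))`. -/
def sUpAux (B : LeftBialgebroid E) (φ : B.RightDual) : E.OpTensor →ₗ[k] A :=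
  BalTensor.lift
    (LinearMap.mk₂ k (fun x y => B.counit (x * E.tgt (op (B.evR φ y))))
      (by intros; simp [add_mul]) (by intros; simp) (by intros; simp [mul_add]) (by intros; simp))
    (by intros; simp [Bimod.lAct_apply, Bimod.rAct_apply, evR_tgt_mul, mul_assoc])

/-- The map `U◂ ⊗^A ▷U → A`, `x ⊗ y ↦ ε(x s(ψ(y)))`. -/
def sDownAux (B : LeftBialgebroid E) (ψ : B.LeftDual) : E.UpTensor →ₗ[k] A :=
  BalTensor.lift
    (LinearMap.mk₂ k (fun x y => B.counit (x * E.src (B.evL ψ y)))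
      (by intros; simp [add_mul]) (by intros; simp) (by intros; simp [mul_add]) (by intros; simp))
    (by intros; simp [Bimod.lAct_apply, Bimod.rAct_apply, evL_src_mul, mul_assoc])

@[simp] theorem sUpAux_tmul (B : LeftBialgebroid E) (φ : B.RightDual) (x y : U) :
    B.sUpAux φ (BalTensor.tmul _ _ x y) = B.counit (x * E.tgt (op (B.evR φ y))) :=
  BalTensor.lift_tmul _ _ _ _

@[simp] theorem sDownAux_tmul (B : LeftBialgebroid E) (ψ : B.LeftDual) (x y : U) :
    B.sDownAux ψ (BalTensor.tmul _ _ x y) = B.counit (x * E.src (B.evL ψ y)) :=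
  BalTensor.lift_tmul _ _ _ _

theorem sUpAux_src_mul (B : LeftBialgebroid E) (h : B.IsLeftHopf) (φ : B.RightDual) (a : A)
    (u : U) : B.sUpAux φ (B.transL h (E.src a * u)) = a * B.sUpAux φ (B.transL h u) := by
  let m : E.OpTensor →ₗ[k] E.OpTensor := BalTensor.map (LinearMap.mulLeft k (E.src a))
    LinearMap.id (by intros; simp [Bimod.lAct_apply, mul_assoc]) (by intros; rfl)
  have hm : ∀ x y : U, m (BalTensor.tmul _ _ x y) = BalTensor.tmul _ _ (E.src a * x) y :=
    fun x y => BalTensor.map_tmul _ _ _ _ _ _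
  have h1 : ∀ z, B.galoisL (m z) = E.leftBimod.tensorL E.leftBimod a (B.galoisL z) := by
    intro z
    induction z using BalTensor.induction with
    | h0 => simp
    | ha y z hy hz => simp only [map_add, hy, hz]
    | ht x y =>
      rw [hm, galoisL_tmul, galoisL_tmul, comul_src_mul]
      induction B.comul x using BalTensor.induction with
      | h0 => simp
      | ha y z hy hz => simp only [map_add, hy, hz]
      | ht x y => simp [Bimod.lAct_apply]
  have h2 : B.transL h (E.src a * u) = m (B.transL h u) := by
    apply h.1
    rw [h1, galoisL_transL, galoisL_transL]
    simp [Bimod.lAct_apply]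
  rw [h2]
  induction B.transL h u using BalTensor.induction with
  | h0 => simp
  | ha y z hy hz => simp only [map_add, mul_add, hy, hz]
  | ht x y => rw [hm]; simp [mul_assoc, counit_src_mul]

theorem sDownAux_tgt_mul (B : LeftBialgebroid E) (h : B.IsRightHopf) (ψ : B.LeftDual) (a : A)
    (u : U) :
    B.sDownAux ψ (B.transR h (E.tgt (op a) * u)) = B.sDownAux ψ (B.transR h u) * a := by
  let m : E.UpTensor →ₗ[k] E.UpTensor := BalTensor.map (LinearMap.mulLeft k (E.tgt (op a)))
    LinearMap.id (by intros; simp [Bimod.rAct_apply, mul_assoc]) (by intros; rfl)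
  have hm : ∀ x y : U, m (BalTensor.tmul _ _ x y) = BalTensor.tmul _ _ (E.tgt (op a) * x) y :=
    fun x y => BalTensor.map_tmul _ _ _ _ _ _
  have h1 : ∀ z, B.galoisR (m z) = E.leftBimod.tensorR E.leftBimod a (B.galoisR z) := by
    intro z
    induction z using BalTensor.induction with
    | h0 => simp
    | ha y z hy hz => simp only [map_add, hy, hz]
    | ht x y =>
      rw [hm, galoisR_tmul, galoisR_tmul, comul_tgt_mul]
      induction B.comul x using BalTensor.induction with
      | h0 => simp
      | ha y z hy hz => simp only [map_add, hy, hz]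
      | ht x y => simp [Bimod.rAct_apply]
  have h2 : B.transR h (E.tgt (op a) * u) = m (B.transR h u) := by
    apply h.1
    rw [h1, galoisR_transR, galoisR_transR]
    simp [Bimod.rAct_apply]
  rw [h2]
  induction B.transR h u using BalTensor.induction with
  | h0 => simp
  | ha y z hy hz => simp only [map_add, add_mul, hy, hz]
  | ht x y => rw [hm]; simp [mul_assoc, counit_tgt_mul]

/-- The map `S^* : U^* → U_*` of a left Hopf algebroid, `S^*(φ)(u) = ε(u₊ t(φ(u₋)))`. -/
noncomputable def sUp (B : LeftBialgebroid E) (h : B.IsLeftHopf) : B.RightDual →ₗ[k] B.LeftDual where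
  toFun φ := B.mkL (B.sUpAux φ ∘ₗ B.transL h) (B.sUpAux_src_mul h φ)
  map_add' φ φ' := LeftDual.ext B fun u => by
    simp only [evL_mkL, map_add, LinearMap.add_apply, LinearMap.comp_apply]
    induction B.transL h u using BalTensor.induction with
    | h0 => simp
    | ha y z hy hz => simp only [map_add, hy, hz]; abel
    | ht x y => simp [mul_add]
  map_smul' c φ := LeftDual.ext B fun u => by
    simp only [evL_mkL, map_smul, LinearMap.smul_apply, LinearMap.comp_apply, RingHom.id_apply]
    induction B.transL h u using BalTensor.induction with
    | h0 => simp
    | ha y z hy hz => simp only [map_add, smul_add, hy, hz]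
    | ht x y => simp

/-- The map `S_* : U_* → U^*` of a right Hopf algebroid, `S_*(ψ)(u) = ε(u₍₊₎ s(ψ(u₍₋₎)))`. -/
noncomputable def sDown (B : LeftBialgebroid E) (h : B.IsRightHopf) :
    B.LeftDual →ₗ[k] B.RightDual where
  toFun ψ := B.mkR (B.sDownAux ψ ∘ₗ B.transR h) (B.sDownAux_tgt_mul h ψ)
  map_add' ψ ψ' := RightDual.ext B fun u => by
    simp only [evR_mkR, map_add, LinearMap.add_apply, LinearMap.comp_apply]
    induction B.transR h u using BalTensor.induction with
    | h0 => simp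
    | ha y z hy hz => simp only [map_add, hy, hz]; abel
    | ht x y => simp [mul_add]
  map_smul' c ψ := RightDual.ext B fun u => by
    simp only [evR_mkR, map_smul, LinearMap.smul_apply, LinearMap.comp_apply, RingHom.id_apply]
    induction B.transR h u using BalTensor.induction with
    | h0 => simp
    | ha y z hy hz => simp only [map_add, smul_add, hy, hz]
    | ht x y => simp

end LeftBialgebroid

end Bialgebroid

/-! Everything rests on extending $S^*(\varphi)$ from $U$ to
$U_\triangleleft\otimes_A{}_\triangleright U$. Put $\beta_\varphi(u\otimes
v)=\epsilon(u_+t(\varphi(u_-v)))$ (`betaL`), so that $\beta_\varphi(x_{(1)}\otimes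
x_{(2)}y)=\epsilon(x\,t(\varphi(y)))$. Then $\beta_\varphi(u\otimes1)=S^*(\varphi)(u)$ and
$\beta_\varphi(1\otimes u)=\varphi(u)$, so both functionals are restrictions of one map. Since
$\alpha_\ell$ turns left multiplication on the first factor into the diagonal action of $U$, one has
$\beta_\varphi(\Delta(u)w)=\epsilon(u\,s(\beta_\varphi(w)))$ (`betaL_diagMul`). The map `betaR`
built from $\alpha_r$ and $\psi\in U_*$ behaves symmetrically, its restrictions being $\psi$ on
$u\otimes1$ and $S_*(\psi)$ on $1\otimes u$.

Inverses: on $\alpha_r(x\otimes y)=\Delta(x)(y\otimes1)$, equivariance gives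
$\beta_\varphi=\epsilon(x\,s(S^*(\varphi)(y)))$, which is the defining formula of `betaR` for
$S^*(\varphi)$. The two maps therefore coincide (`betaL_eq_betaR`), and restricting to $1\otimes u$
yields $S_*S^*=\mathrm{id}$; the other composite is symmetric.

Multiplicativity: before applying $\epsilon$, consider $\theta_\varphi(u\otimes
v)=u_+t(\varphi(u_-v))\in U$. Coassociativity gives $\theta_\varphi(u\otimes
v)=t(\beta_\varphi(u_{(2)}\otimes v))u_{(1)}$ (`thetaL_eq`), and multiplicativity of $\Delta$ with
the Takeuchi condition gives $\beta_{\varphi\varphi'}(u\otimes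
v)=\beta_{\varphi'}(\theta_\varphi(u\otimes v_{(1)})\otimes v_{(2)})$ (`betaL_mul`). At $v=1$ these
combine to the product formula in $U_*$. That $S_*$ is a morphism follows because it is inverse to
one.

Bialgebroids: dual bases make the pairings of $U\otimes U$ with the tensor squares of the duals
nondegenerate, which gives uniqueness and reduces the axioms for $U^*$ to identities in $U$. The
structure on $U_*$ is not constructed separately: it is transported along $S^*$, and `evL_sUp_mul`
shows that the transported coproduct is dual to the product of $U$. Uniqueness then identifies any
dual structure on $U_*$ with the transported one, for which $S^*$ is an isomorphism by construction.
-/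

namespace Bialgebroid

open scoped TensorProduct
open MulOpposite

universe u v w w' w''

/-! ### Multiplication operators on the tensor products -/

namespace AeRing

variable {k : Type u} {A : Type v} [CommRing k] [Ring A] [Algebra k A]
variable {U : Type w} [Ring U] [Algebra k U]

@[simp] theorem leftTakeuchiMul_tmul (E : AeRing k A U) (x : E.LTensor)
    (hx : E.IsLeftTakeuchi x) (v v' : U) :
    E.leftTakeuchiMul x hx (BalTensor.tmul _ _ v v') = E.rmul v v' x :=
  BalTensor.lift_tmul _ _ _ _

@[simp] theorem rightTakeuchiMul_tmul (E : AeRing k A U) (y : E.RTensor)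
    (hy : E.IsRightTakeuchi y) (v v' : U) :
    E.rightTakeuchiMul y hy (BalTensor.tmul _ _ v v') = E.lmul v v' y :=
  BalTensor.lift_tmul _ _ _ _

/-- Left and right factorwise multiplications commute; this is what lets the Hopf–Galois maps
intertwine left multiplication with the diagonal action. -/
theorem leftTakeuchiMul_rmul (E : AeRing k A U) (x : E.LTensor) (hx : E.IsLeftTakeuchi x)
    (v v' : U) (z : E.LTensor) :
    E.leftTakeuchiMul x hx (E.rmul v v' z) = E.rmul v v' (E.leftTakeuchiMul x hx z) := by
  induction z using BalTensor.induction with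
  | h0 => simp
  | ha y z hy hz => simp only [map_add, hy, hz]
  | ht y z => simp [rmul_rmul]

/-- Left multiplication `x ⊗ y ↦ u x ⊗ y` on `▸U ⊗_{Aᵒᵖ} U◁`. -/
def opLmul (E : AeRing k A U) (u : U) : E.OpTensor →ₗ[k] E.OpTensor :=
  BalTensor.map (LinearMap.mulLeft k u) LinearMap.id
    (by intros; simp [Bimod.lAct_apply, mul_assoc]) (by intros; rfl)

@[simp] theorem opLmul_tmul (E : AeRing k A U) (u x y : U) :
    E.opLmul u (BalTensor.tmul _ _ x y) = BalTensor.tmul _ _ (u * x) y :=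
  BalTensor.map_tmul _ _ _ _ _ _

/-- Left multiplication `x ⊗ y ↦ u x ⊗ y` on `U◂ ⊗^A ▷U`. -/
def upLmul (E : AeRing k A U) (u : U) : E.UpTensor →ₗ[k] E.UpTensor :=
  BalTensor.map (LinearMap.mulLeft k u) LinearMap.id
    (by intros; simp [Bimod.rAct_apply, mul_assoc]) (by intros; rfl)

@[simp] theorem upLmul_tmul (E : AeRing k A U) (u x y : U) :
    E.upLmul u (BalTensor.tmul _ _ x y) = BalTensor.tmul _ _ (u * x) y :=
  BalTensor.map_tmul _ _ _ _ _ _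

end AeRing

/-! ### The extended functionals $\beta$, and $S^*$, $S_*$ as mutual inverses -/

namespace LeftBialgebroid

variable {k : Type u} {A : Type v} {U : Type w} [CommRing k] [Ring A] [Algebra k A]
  [Ring U] [Algebra k U] {E : AeRing k A U}

theorem comul_src (B : LeftBialgebroid E) (a : A) :
    B.comul (E.src a) = BalTensor.tmul _ _ (E.src a) 1 := by
  rw [← mul_one (E.src a), comul_src_mul, comul_one]; simp [Bimod.lAct_apply]

theorem comul_tgt (B : LeftBialgebroid E) (a : A) :
    B.comul (E.tgt (op a)) = BalTensor.tmul _ _ 1 (E.tgt (op a)) := by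
  rw [← mul_one (E.tgt (op a)), comul_tgt_mul, comul_one]; simp [Bimod.rAct_apply]

theorem counit_tgt (B : LeftBialgebroid E) (a : A) : B.counit (E.tgt (op a)) = a := by
  simpa [B.counit_one] using B.counit_tgt_mul a 1

/-- The left action of `U` on `U◁ ⊗_A ▷U` through the coproduct. -/
def diagMul (B : LeftBialgebroid E) (u : U) : E.LTensor →ₗ[k] E.LTensor :=
  E.leftTakeuchiMul (B.comul u) (B.comul_takeuchi u)

@[simp] theorem diagMul_tmul (B : LeftBialgebroid E) (u v v' : U) :
    B.diagMul u (BalTensor.tmul _ _ v v') = E.rmul v v' (B.comul u) :=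
  E.leftTakeuchiMul_tmul _ (B.comul_takeuchi u) v v'

theorem diagMul_comul (B : LeftBialgebroid E) (u v : U) :
    B.diagMul u (B.comul v) = B.comul (u * v) := (B.comul_mul u v).symm

theorem diagMul_src (B : LeftBialgebroid E) (a : A) (z : E.LTensor) :
    B.diagMul (E.src a) z = E.leftBimod.tensorL E.leftBimod a z := by
  induction z using BalTensor.induction with
  | h0 => simp
  | ha y z hy hz => simp only [map_add, hy, hz]
  | ht y z => simp [comul_src, Bimod.lAct_apply]

theorem diagMul_tgt (B : LeftBialgebroid E) (a : A) (z : E.LTensor) :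
    B.diagMul (E.tgt (op a)) z = E.leftBimod.tensorR E.leftBimod a z := by
  induction z using BalTensor.induction with
  | h0 => simp
  | ha y z hy hz => simp only [map_add, hy, hz]
  | ht y z => simp [comul_tgt, Bimod.rAct_apply]

/-- Since $\alpha_\ell(x\otimes y)=\Delta(x)(1\otimes y)$, this is multiplicativity of $\Delta$. -/
theorem galoisL_opLmul (B : LeftBialgebroid E) (u : U) (z : E.OpTensor) :
    B.galoisL (E.opLmul u z) = B.diagMul u (B.galoisL z) := by
  induction z using BalTensor.induction with
  | h0 => simp
  | ha y z hy hz => simp only [map_add, hy, hz]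
  | ht y z =>
    rw [AeRing.opLmul_tmul, galoisL_tmul, galoisL_tmul, comul_mul, diagMul,
      AeRing.leftTakeuchiMul_rmul]

theorem galoisR_upLmul (B : LeftBialgebroid E) (u : U) (z : E.UpTensor) :
    B.galoisR (E.upLmul u z) = B.diagMul u (B.galoisR z) := by
  induction z using BalTensor.induction with
  | h0 => simp
  | ha y z hy hz => simp only [map_add, hy, hz]
  | ht y z =>
    rw [AeRing.upLmul_tmul, galoisR_tmul, galoisR_tmul, comul_mul, diagMul,
      AeRing.leftTakeuchiMul_rmul]

/-- The Hopf–Galois map of a left Hopf algebroid as an equivalence. -/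
noncomputable def galoisLEquiv (B : LeftBialgebroid E) (h : B.IsLeftHopf) :
    E.OpTensor ≃ₗ[k] E.LTensor := LinearEquiv.ofBijective B.galoisL h

/-- The Hopf–Galois map of a right Hopf algebroid as an equivalence. -/
noncomputable def galoisREquiv (B : LeftBialgebroid E) (h : B.IsRightHopf) :
    E.UpTensor ≃ₗ[k] E.LTensor := LinearEquiv.ofBijective B.galoisR h

/-- The map `U◁ ⊗_A ▷U → A`, `u ⊗ v ↦ ε(u₊ t(φ(u₋ v)))`. -/
noncomputable def betaL (B : LeftBialgebroid E) (h : B.IsLeftHopf) (φ : B.RightDual) :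
    E.LTensor →ₗ[k] A := B.sUpAux φ ∘ₗ (B.galoisLEquiv h).symm.toLinearMap

/-- The map `U◁ ⊗_A ▷U → A`, `u ⊗ v ↦ ε(v₍₊₎ s(ψ(v₍₋₎ u)))`. -/
noncomputable def betaR (B : LeftBialgebroid E) (h : B.IsRightHopf) (ψ : B.LeftDual) :
    E.LTensor →ₗ[k] A := B.sDownAux ψ ∘ₗ (B.galoisREquiv h).symm.toLinearMap

theorem betaL_galoisL (B : LeftBialgebroid E) (h : B.IsLeftHopf) (φ : B.RightDual)
    (z : E.OpTensor) : B.betaL h φ (B.galoisL z) = B.sUpAux φ z :=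
  congrArg (B.sUpAux φ) ((B.galoisLEquiv h).symm_apply_apply z)

theorem betaR_galoisR (B : LeftBialgebroid E) (h : B.IsRightHopf) (ψ : B.LeftDual)
    (z : E.UpTensor) : B.betaR h ψ (B.galoisR z) = B.sDownAux ψ z :=
  congrArg (B.sDownAux ψ) ((B.galoisREquiv h).symm_apply_apply z)

/-- The working description of $\beta_\varphi$: as $\alpha_\ell$ is onto, the elements
$\Delta(x)(1\otimes y)$ span, and identities for $\beta_\varphi$ are checked on them without
handling $u_+\otimes u_-$. -/
theorem betaL_rmul_comul (B : LeftBialgebroid E) (h : B.IsLeftHopf) (φ : B.RightDual) (x y : U) :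
    B.betaL h φ (E.rmul 1 y (B.comul x)) = B.counit (x * E.tgt (op (B.evR φ y))) := by
  rw [← galoisL_tmul, betaL_galoisL, sUpAux_tmul]

theorem betaR_rmul_comul (B : LeftBialgebroid E) (h : B.IsRightHopf) (ψ : B.LeftDual) (x y : U) :
    B.betaR h ψ (E.rmul y 1 (B.comul x)) = B.counit (x * E.src (B.evL ψ y)) := by
  rw [← galoisR_tmul, betaR_galoisR, sDownAux_tmul]

theorem evL_sUp (B : LeftBialgebroid E) (h : B.IsLeftHopf) (φ : B.RightDual) (u : U) :
    B.evL (B.sUp h φ) u = B.betaL h φ (BalTensor.tmul _ _ u 1) := rfl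

theorem evR_sDown (B : LeftBialgebroid E) (h : B.IsRightHopf) (ψ : B.LeftDual) (u : U) :
    B.evR (B.sDown h ψ) u = B.betaR h ψ (BalTensor.tmul _ _ 1 u) := rfl

/-- Take $x=1$: $\alpha_\ell(1\otimes u)=1\otimes u$ and $\epsilon(t(a))=a$. -/
theorem betaL_one_tmul (B : LeftBialgebroid E) (h : B.IsLeftHopf) (φ : B.RightDual) (u : U) :
    B.betaL h φ (BalTensor.tmul _ _ 1 u) = B.evR φ u := by
  have := B.betaL_rmul_comul h φ 1 u
  simpa [comul_one, counit_tgt] using this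

theorem betaR_tmul_one (B : LeftBialgebroid E) (h : B.IsRightHopf) (ψ : B.LeftDual) (u : U) :
    B.betaR h ψ (BalTensor.tmul _ _ u 1) = B.evL ψ u := by
  have := B.betaR_rmul_comul h ψ 1 u
  simpa [comul_one, counit_src] using this

/-- Through $\alpha_\ell$ the diagonal action becomes left multiplication on the first factor, and
then $\epsilon(uv)=\epsilon(u\,s(\epsilon(v)))$ finishes. -/
theorem betaL_diagMul (B : LeftBialgebroid E) (h : B.IsLeftHopf) (φ : B.RightDual) (u : U)
    (w : E.LTensor) :
    B.betaL h φ (B.diagMul u w) = B.counit (u * E.src (B.betaL h φ w)) := by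
  obtain ⟨z, rfl⟩ := h.2 w
  rw [← galoisL_opLmul, betaL_galoisL, betaL_galoisL]
  induction z using BalTensor.induction with
  | h0 => simp
  | ha y z hy hz => simp only [map_add, mul_add, hy, hz]
  | ht y z => simp [mul_assoc, ← counit_mul_src]

theorem betaR_diagMul (B : LeftBialgebroid E) (h : B.IsRightHopf) (ψ : B.LeftDual) (u : U)
    (w : E.LTensor) :
    B.betaR h ψ (B.diagMul u w) = B.counit (u * E.tgt (op (B.betaR h ψ w))) := by
  obtain ⟨z, rfl⟩ := h.2 w
  rw [← galoisR_upLmul, betaR_galoisR, betaR_galoisR]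
  induction z using BalTensor.induction with
  | h0 => simp
  | ha y z hy hz => simp only [map_add, op_add, mul_add, hy, hz]
  | ht y z => simp [mul_assoc, ← counit_mul_tgt]

/-- Equivariance for $u=s(a)$, whose diagonal action is the left $A$-action because
$\Delta(s(a))=s(a)\otimes1$; the right action below comes from $t(a)$ in the same way. -/
theorem betaL_tensorL (B : LeftBialgebroid E) (h : B.IsLeftHopf) (φ : B.RightDual) (a : A)
    (w : E.LTensor) :
    B.betaL h φ (E.leftBimod.tensorL E.leftBimod a w) = a * B.betaL h φ w := by
  rw [← diagMul_src, betaL_diagMul, counit_src_mul, counit_src]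

theorem betaL_tensorR (B : LeftBialgebroid E) (h : B.IsLeftHopf) (φ : B.RightDual) (a : A)
    (w : E.LTensor) :
    B.betaL h φ (E.leftBimod.tensorR E.leftBimod a w) = B.betaL h φ w * a := by
  rw [← diagMul_tgt, betaL_diagMul, counit_tgt_mul, counit_src]

/-- The one place where the two Hopf–Galois maps meet: $\beta_\varphi$ is defined through
$\alpha_\ell$ but tested on $\alpha_r(y\otimes z)=\Delta(y)(z\otimes1)$, where equivariance
expresses it through its values on $z\otimes1$ alone. -/
theorem betaL_eq_betaR (B : LeftBialgebroid E) (hl : B.IsLeftHopf) (hr : B.IsRightHopf)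
    (φ : B.RightDual) : B.betaL hl φ = B.betaR hr (B.sUp hl φ) := by
  ext w
  obtain ⟨z, rfl⟩ := hr.2 w
  rw [betaR_galoisR]
  induction z using BalTensor.induction with
  | h0 => simp
  | ha y z hy hz => simp only [map_add, hy, hz]
  | ht y z =>
    rw [galoisR_tmul, sDownAux_tmul, evL_sUp, ← betaL_diagMul, diagMul_tmul]

theorem betaR_eq_betaL (B : LeftBialgebroid E) (hl : B.IsLeftHopf) (hr : B.IsRightHopf)
    (ψ : B.LeftDual) : B.betaR hr ψ = B.betaL hl (B.sDown hr ψ) := by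
  ext w
  obtain ⟨z, rfl⟩ := hl.2 w
  rw [betaL_galoisL]
  induction z using BalTensor.induction with
  | h0 => simp
  | ha y z hy hz => simp only [map_add, hy, hz]
  | ht y z =>
    rw [galoisL_tmul, sUpAux_tmul, evR_sDown, ← betaR_diagMul, diagMul_tmul]

theorem sDown_sUp (B : LeftBialgebroid E) (hl : B.IsLeftHopf) (hr : B.IsRightHopf)
    (φ : B.RightDual) : B.sDown hr (B.sUp hl φ) = φ :=
  RightDual.ext B fun u => by rw [evR_sDown, ← betaL_eq_betaR, betaL_one_tmul]

theorem sUp_sDown (B : LeftBialgebroid E) (hl : B.IsLeftHopf) (hr : B.IsRightHopf)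
    (ψ : B.LeftDual) : B.sUp hl (B.sDown hr ψ) = ψ :=
  LeftDual.ext B fun u => by rw [evL_sUp, ← betaR_eq_betaL, betaR_tmul_one]

theorem evL_sUp_one (B : LeftBialgebroid E) (h : B.IsLeftHopf) (φ : B.RightDual) :
    B.evL (B.sUp h φ) 1 = B.evR φ 1 := by
  rw [evL_sUp, betaL_one_tmul]

/-! ### Behaviour of $S^*$ on source and target -/

/-- The map `▸U ⊗_{Aᵒᵖ} U◁ → U`, `x ⊗ y ↦ x t(φ(y))`. -/
def actAux (B : LeftBialgebroid E) (φ : B.RightDual) : E.OpTensor →ₗ[k] U :=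
  BalTensor.lift
    (LinearMap.mk₂ k (fun x y => x * E.tgt (op (B.evR φ y)))
      (by intros; simp [add_mul]) (by intros; simp) (by intros; simp [mul_add]) (by intros; simp))
    (by intros; simp [Bimod.lAct_apply, Bimod.rAct_apply, evR_tgt_mul, mul_assoc])

@[simp] theorem actAux_tmul (B : LeftBialgebroid E) (φ : B.RightDual) (x y : U) :
    B.actAux φ (BalTensor.tmul _ _ x y) = x * E.tgt (op (B.evR φ y)) :=
  BalTensor.lift_tmul _ _ _ _

/-- `u₊ t(ε(u₋)) = u`. -/
theorem actAux_one_transL (B : LeftBialgebroid E) (h : B.IsLeftHopf) (u : U) :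
    B.actAux 1 (B.transL h u) = u := by
  -- Both sides on $x\otimes y$ are $t(\epsilon(x_{(2)}y))x_{(1)}$; evaluating at
  -- $\alpha_\ell^{-1}(u\otimes1)$ leaves the contraction of $u\otimes1$, which is $u$.
  have key : ∀ z, B.actAux 1 z = E.leftBimod.contractR B.counit B.counit_l (B.galoisL z) := by
    intro z
    induction z using BalTensor.induction with
    | h0 => simp
    | ha y z hy hz => simp only [map_add, hy, hz]
    | ht x y =>
      rw [actAux_tmul, galoisL_tmul, evR_one]
      conv_lhs => rw [← B.comul_counit (x * _), comul_mul_tgt]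
      induction B.comul x using BalTensor.induction with
      | h0 => simp
      | ha y z hy hz => simp only [map_add, hy, hz]
      | ht a b => simp [← counit_mul_tgt]
  rw [key, galoisL_transL]
  simp [Bimod.rAct_apply, counit_one]

/-- `S^*(s^*(a)) = s_*(a)`. -/
theorem sUp_srcR (B : LeftBialgebroid E) (h : B.IsLeftHopf) (a : A) :
    B.sUp h (B.srcR a) = B.srcL a := by
  -- Contracting $\alpha_\ell(x\otimes y)$ by $\epsilon$ on the first leg recovers $xy$, and
  -- $\epsilon(x\,t(\epsilon(y\,s(a))))=\epsilon(xy\,s(a))$.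
  have key : ∀ z, B.sUpAux (B.srcR a) z =
      B.counit (E.leftBimod.contractL B.counit B.counit_r (B.galoisL z) * E.src a) := by
    intro z
    induction z using BalTensor.induction with
    | h0 => simp
    | ha y z hy hz => simp only [map_add, add_mul, hy, hz]
    | ht x y =>
      have h1 : E.leftBimod.contractL B.counit B.counit_r (E.rmul 1 y (B.comul x)) = x * y := by
        conv_rhs => rw [← B.counit_comul x]
        induction B.comul x using BalTensor.induction with
        | h0 => simp
        | ha y z hy hz => simp only [map_add, add_mul, hy, hz]
        | ht a b => simp [Bimod.lAct_apply, mul_assoc]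
      rw [galoisL_tmul, h1, sUpAux_tmul, evR_srcR, ← counit_mul_tgt, mul_assoc]
  refine LeftDual.ext B fun u => ?_
  change B.sUpAux (B.srcR a) (B.transL h u) = _
  rw [key, galoisL_transL]
  simp [Bimod.lAct_apply, counit_src_mul, counit_src]

/-- `S^*(t^*(a)) = t_*(a)`. -/
theorem sUp_tgtR (B : LeftBialgebroid E) (h : B.IsLeftHopf) (a : A) :
    B.sUp h (B.tgtR a) = B.tgtL a := by
  refine LeftDual.ext B fun u => ?_
  change B.sUpAux (B.tgtR a) (B.transL h u) = _
  rw [evL_tgtL]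
  conv_rhs => rw [← B.actAux_one_transL h u]
  induction B.transL h u using BalTensor.induction with
  | h0 => simp
  | ha y z hy hz => simp only [map_add, add_mul, hy, hz]
  | ht x y => simp [mul_assoc]

end LeftBialgebroid

/-! ### Finite sums of pure tensors and the inverse associator -/

namespace BalTensor

variable {k : Type u} {A : Type v} [CommRing k]
variable {M N : Type*} [AddCommGroup M] [Module k M] [AddCommGroup N] [Module k N]
variable {ρ : A → Module.End k M} {l : A → Module.End k N}

@[simp] theorem zero_tmul (n : N) : tmul ρ l 0 n = 0 := by
  simp [tmul]

@[simp] theorem tmul_zero (m : M) : tmul ρ l m 0 = 0 := by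
  simp [tmul]

/-- Needed where induction on a tensor is unavailable: when the tensor enters through a hypothesis
that its separate summands do not satisfy, or when an operation is defined only for a chosen
representative. -/
theorem exists_sum (z : BalTensor ρ l) :
    ∃ (ι : Type) (_ : Fintype ι) (f : ι → M) (g : ι → N), z = ∑ i, tmul ρ l (f i) (g i) := by
  induction z using induction with
  | h0 => exact ⟨Empty, inferInstance, Empty.elim, Empty.elim, by simp⟩
  | ht m n => exact ⟨Unit, inferInstance, fun _ => m, fun _ => n, by simp⟩
  | ha y z hy hz =>
    obtain ⟨ι, _, f, g, rfl⟩ := hy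
    obtain ⟨ι', _, f', g', rfl⟩ := hz
    exact ⟨ι ⊕ ι', inferInstance, Sum.elim f f', Sum.elim g g', by simp⟩

theorem sum_tmul {ι : Type*} (s : Finset ι) (f : ι → M) (n : N) :
    tmul ρ l (∑ i ∈ s, f i) n = ∑ i ∈ s, tmul ρ l (f i) n := by
  simp only [← mk_apply, map_sum, LinearMap.sum_apply]

theorem tmul_sum {ι : Type*} (s : Finset ι) (m : M) (g : ι → N) :
    tmul ρ l m (∑ i ∈ s, g i) = ∑ i ∈ s, tmul ρ l m (g i) := by
  simp only [← mk_apply, map_sum]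

end BalTensor

namespace Bimod

variable {k : Type u} {A : Type v} [CommRing k] [Ring A] [Algebra k A]
variable {C D G : Type*} [AddCommGroup C] [Module k C] [AddCommGroup D] [Module k D]
  [AddCommGroup G] [Module k G]

/-- The map `D ⊗_A G → (C ⊗_A D) ⊗_A G`, `y ⊗ z ↦ (x ⊗ y) ⊗ z`. -/
def assocInvAux (X : Bimod k A C) (Y : Bimod k A D) (Z : Bimod k A G) (x : C) :
    Y.Tensor Z →ₗ[k] BalTensor (X.tensorR Y) Z.lAct :=
  BalTensor.map (BalTensor.mk X.rAct Y.lAct x) LinearMap.id (by intros; simp) (by intros; rfl)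

@[simp] theorem assocInvAux_tmul (X : Bimod k A C) (Y : Bimod k A D) (Z : Bimod k A G)
    (x : C) (y : D) (z : G) :
    X.assocInvAux Y Z x (BalTensor.tmul _ _ y z) =
      BalTensor.tmul _ _ (BalTensor.tmul _ _ x y) z :=
  BalTensor.map_tmul _ _ _ _ _ _

/-- The canonical map `C ⊗_A (D ⊗_A G) → (C ⊗_A D) ⊗_A G`, `x ⊗ (y ⊗ z) ↦ (x ⊗ y) ⊗ z`. -/
def assocInv (X : Bimod k A C) (Y : Bimod k A D) (Z : Bimod k A G) :
    BalTensor X.rAct (Y.tensorL Z) →ₗ[k] BalTensor (X.tensorR Y) Z.lAct :=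
  BalTensor.lift
    (LinearMap.mk₂ k (fun x w => X.assocInvAux Y Z x w)
      (fun x x' => LinearMap.congr_fun (f := X.assocInvAux Y Z (x + x'))
        (g := X.assocInvAux Y Z x + X.assocInvAux Y Z x')
        (BalTensor.ext (by intros; simp [BalTensor.add_tmul])))
      (fun c x => LinearMap.congr_fun (f := X.assocInvAux Y Z (c • x))
        (g := c • X.assocInvAux Y Z x)
        (BalTensor.ext (by intros; simp [BalTensor.smul_tmul'])))
      (by intros; simp) (by intros; simp))
    (fun a x => LinearMap.congr_fun (f := X.assocInvAux Y Z (X.rAct a x))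
      (g := X.assocInvAux Y Z x ∘ₗ Y.tensorL Z a)
      (BalTensor.ext (by intros; simp [BalTensor.tmul_balanced])))

@[simp] theorem assocInv_tmul (X : Bimod k A C) (Y : Bimod k A D) (Z : Bimod k A G)
    (x : C) (y : D) (z : G) :
    X.assocInv Y Z (BalTensor.tmul _ _ x (BalTensor.tmul _ _ y z)) =
      BalTensor.tmul _ _ (BalTensor.tmul _ _ x y) z :=
  (BalTensor.lift_tmul _ _ _ _).trans (X.assocInvAux_tmul Y Z x y z)

end Bimod

/-! ### Multiplicativity of $S^*$ -/

namespace LeftBialgebroid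

variable {k : Type u} {A : Type v} {U : Type w} [CommRing k] [Ring A] [Algebra k A]
  [Ring U] [Algebra k U] {E : AeRing k A U}

/-- The map `U◁ ⊗_A ▷U → U`, `u ⊗ v ↦ u₊ t(φ(u₋ v))`. -/
noncomputable def thetaL (B : LeftBialgebroid E) (h : B.IsLeftHopf) (φ : B.RightDual) :
    E.LTensor →ₗ[k] U := B.actAux φ ∘ₗ (B.galoisLEquiv h).symm.toLinearMap

theorem thetaL_galoisL (B : LeftBialgebroid E) (h : B.IsLeftHopf) (φ : B.RightDual)
    (z : E.OpTensor) : B.thetaL h φ (B.galoisL z) = B.actAux φ z :=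
  congrArg (B.actAux φ) ((B.galoisLEquiv h).symm_apply_apply z)

theorem thetaL_diagMul (B : LeftBialgebroid E) (h : B.IsLeftHopf) (φ : B.RightDual) (u : U)
    (w : E.LTensor) : B.thetaL h φ (B.diagMul u w) = u * B.thetaL h φ w := by
  obtain ⟨z, rfl⟩ := h.2 w
  rw [← galoisL_opLmul, thetaL_galoisL, thetaL_galoisL]
  induction z using BalTensor.induction with
  | h0 => simp
  | ha y z hy hz => simp only [map_add, mul_add, hy, hz]
  | ht y z => simp [mul_assoc]

/-- The map `x ⊗ w ↦ t(β(w)) x` on `U◁ ⊗_A (U◁ ⊗_A ▷U)`, for `β(u ⊗ v) = ε(u₊ t(φ(u₋ v)))`. -/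
noncomputable def contractBeta (B : LeftBialgebroid E) (h : B.IsLeftHopf) (φ : B.RightDual) :
    BalTensor E.leftBimod.rAct (E.leftBimod.tensorL E.leftBimod) →ₗ[k] U :=
  BalTensor.lift
    (LinearMap.mk₂ k (fun x w => E.tgt (op (B.betaL h φ w)) * x)
      (by intros; simp [mul_add]) (by intros; simp) (by intros; simp [add_mul]) (by intros; simp))
    (by intros; simp [Bimod.rAct_apply, betaL_tensorL, mul_assoc])

@[simp] theorem contractBeta_tmul (B : LeftBialgebroid E) (h : B.IsLeftHopf) (φ : B.RightDual)
    (x : U) (w : E.LTensor) :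
    B.contractBeta h φ (BalTensor.tmul _ _ x w) = E.tgt (op (B.betaL h φ w)) * x :=
  BalTensor.lift_tmul _ _ _ _

theorem rmul_tensorL (E : AeRing k A U) (v v' : U) (a : A) (z : E.LTensor) :
    E.rmul v v' (E.leftBimod.tensorL E.leftBimod a z) =
      E.leftBimod.tensorL E.leftBimod a (E.rmul v v' z) := by
  induction z using BalTensor.induction with
  | h0 => simp
  | ha y z hy hz => simp only [map_add, hy, hz]
  | ht y z => simp [Bimod.lAct_apply, mul_assoc]

/-- The map `id ⊗ (- · (v ⊗ v'))` on `U◁ ⊗_A (U◁ ⊗_A ▷U)`. -/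
def rmul₂ (E : AeRing k A U) (v v' : U) :
    BalTensor E.leftBimod.rAct (E.leftBimod.tensorL E.leftBimod) →ₗ[k]
      BalTensor E.leftBimod.rAct (E.leftBimod.tensorL E.leftBimod) :=
  BalTensor.map LinearMap.id (E.rmul v v') (by intros; rfl) (rmul_tensorL E v v')

@[simp] theorem rmul₂_tmul (E : AeRing k A U) (v v' x : U) (w : E.LTensor) :
    rmul₂ E v v' (BalTensor.tmul _ _ x w) = BalTensor.tmul _ _ x (E.rmul v v' w) :=
  BalTensor.map_tmul _ _ _ _ _ _

/-- Pulls the factor $y$ of $\Delta(x)(1\otimes y)$ out to the last leg, so that coassociativity can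
be applied to $\Delta(x)$ itself. -/
theorem assoc_mapL_rmul (B : LeftBialgebroid E) (y : U) (z : E.LTensor) :
    E.leftBimod.assoc E.leftBimod E.leftBimod
      (E.leftBimod.mapL B.comul B.comul_r (E.rmul 1 y z)) =
    rmul₂ E 1 y (E.leftBimod.assoc E.leftBimod E.leftBimod
      (E.leftBimod.mapL B.comul B.comul_r z)) := by
  induction z using BalTensor.induction with
  | h0 => simp
  | ha y z hy hz => simp only [map_add, hy, hz]
  | ht a b =>
    rw [AeRing.rmul_tmul, Bimod.mapL_tmul, Bimod.mapL_tmul, mul_one]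
    induction B.comul a using BalTensor.induction with
    | h0 => simp
    | ha y z hy hz => simp only [map_add, BalTensor.add_tmul, hy, hz]
    | ht c d => simp

/-- `u₊ t(φ(u₋ v)) = t(β(u₍₂₎ ⊗ v)) u₍₁₎` for `β(u ⊗ v) = ε(u₊ t(φ(u₋ v)))`. -/
theorem thetaL_eq (B : LeftBialgebroid E) (h : B.IsLeftHopf) (φ : B.RightDual) (w : E.LTensor) :
    B.thetaL h φ w = B.contractBeta h φ (E.leftBimod.assoc E.leftBimod E.leftBimod
      (E.leftBimod.mapL B.comul B.comul_r w)) := by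
  obtain ⟨z, rfl⟩ := h.2 w
  rw [thetaL_galoisL]
  induction z using BalTensor.induction with
  | h0 => simp
  | ha y z hy hz => simp only [map_add, hy, hz]
  | ht x y =>
    rw [galoisL_tmul, assoc_mapL_rmul, B.coassoc, actAux_tmul]
    -- The counit axiom writes $x\,t(\varphi(y))$ as $t(\epsilon(x_{(2)}t(\varphi(y))))x_{(1)}$, and
    -- the inner counit is $\beta_\varphi(\Delta(x_{(2)})(1\otimes y))$.
    conv_lhs => rw [← B.comul_counit (x * _), comul_mul_tgt]
    induction B.comul x using BalTensor.induction with
    | h0 => simp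
    | ha y z hy hz => simp only [map_add, hy, hz]
    | ht a b => simp [Bimod.rAct_apply, betaL_rmul_comul]

/-- By `thetaL_eq`, $\theta_\varphi(u\otimes1)=t(S^*(\varphi)(u_{(2)}))u_{(1)}$. For
$f=S^*(\varphi')$ the right side is the product $S^*(\varphi)S^*(\varphi')$ at $u$. -/
theorem thetaL_tmul_one (B : LeftBialgebroid E) (h : B.IsLeftHopf) (φ : B.RightDual) (u : U)
    (f : U →ₗ[k] A) :
    f (B.thetaL h φ (BalTensor.tmul _ _ u 1)) = B.convL (B.sUp h φ) f (B.comul u) := by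
  rw [thetaL_eq, Bimod.mapL_tmul]
  induction B.comul u using BalTensor.induction with
  | h0 => simp
  | ha y z hy hz => simp only [map_add, BalTensor.add_tmul, hy, hz]
  | ht a b => simp [evL_sUp]

/-- The map `x ⊗ (y ⊗ z) ↦ θ(x ⊗ y) ⊗ z`, for `θ(u ⊗ v) = u₊ t(φ(u₋ v))`. -/
noncomputable def thetaL₂ (B : LeftBialgebroid E) (h : B.IsLeftHopf) (φ : B.RightDual) :
    BalTensor E.leftBimod.rAct (E.leftBimod.tensorL E.leftBimod) →ₗ[k] E.LTensor :=
  BalTensor.map (ρ := E.leftBimod.tensorR E.leftBimod) (l := E.leftBimod.lAct)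
      (B.thetaL h φ) LinearMap.id
      (fun a w => by
        rw [← diagMul_tgt, thetaL_diagMul, Bimod.rAct_apply, AeRing.leftBimod_r])
      (by intros; rfl) ∘ₗ
    E.leftBimod.assocInv E.leftBimod E.leftBimod

@[simp] theorem thetaL₂_tmul (B : LeftBialgebroid E) (h : B.IsLeftHopf) (φ : B.RightDual)
    (x y z : U) : B.thetaL₂ h φ (BalTensor.tmul _ _ x (BalTensor.tmul _ _ y z)) =
      BalTensor.tmul _ _ (B.thetaL h φ (BalTensor.tmul _ _ x y)) z := by
  rw [thetaL₂, LinearMap.comp_apply, Bimod.assocInv_tmul]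
  exact BalTensor.map_tmul _ _ _ _ _ _

theorem thetaL₂_rmul₂_assoc (B : LeftBialgebroid E) (h : B.IsLeftHopf) (φ : B.RightDual)
    (v v' : U) (w : E.LTensor) (b : U) :
    B.thetaL₂ h φ (rmul₂ E v v' (E.leftBimod.assoc E.leftBimod E.leftBimod
      (BalTensor.tmul _ _ w b))) = BalTensor.tmul _ _ (B.thetaL h φ (E.rmul 1 v w)) (b * v') := by
  induction w using BalTensor.induction with
  | h0 => simp
  | ha y z hy hz => simp only [map_add, BalTensor.add_tmul, hy, hz]
  | ht x y => simp

/-- Multiplicativity of $\Delta$ on the second leg. Right multiplication is available for pure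
tensors only, hence the explicit representative of $\Delta(y)$. -/
theorem mapR_rmul (B : LeftBialgebroid E) (y : U) {ι : Type} [Fintype ι] (f g : ι → U)
    (hy : B.comul y = ∑ i, BalTensor.tmul _ _ (f i) (g i)) (z : E.LTensor) :
    E.leftBimod.mapR B.comul B.comul_l (E.rmul 1 y z) =
      ∑ i, rmul₂ E (f i) (g i) (E.leftBimod.mapR B.comul B.comul_l z) := by
  induction z using BalTensor.induction with
  | h0 => simp
  | ha a b ha hb => simp only [map_add, ha, hb, Finset.sum_add_distrib]
  | ht a b =>
    rw [AeRing.rmul_tmul, Bimod.mapR_tmul, Bimod.mapR_tmul, mul_one, ← diagMul_comul, hy]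
    simp [BalTensor.tmul_sum]

/-- The Takeuchi condition: to the right of $\Delta(u)$, a factor $s(a)$ on the second leg may be
exchanged for $t(a)$ on the first. -/
theorem rmul_one_src_mul (B : LeftBialgebroid E) (a : A) (u v : U) :
    E.rmul 1 (E.src a * v) (B.comul u) = E.rmul (E.tgt (op a)) v (B.comul u) := by
  have := congrArg (E.rmul 1 v) (B.comul_takeuchi u a)
  rw [AeRing.rmul_rmul, AeRing.rmul_rmul] at this
  simpa using this.symm

/-- After coassociativity $\theta_\varphi$ meets $\Delta(x_{(1)})(1\otimes
v)=\alpha_\ell(x_{(1)}\otimes v)$ and returns $x_{(1)}t(\varphi(v))$; the Takeuchi condition moves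
$\varphi(v)$ to the second leg. -/
theorem thetaL₂_mapR (B : LeftBialgebroid E) (h : B.IsLeftHopf) (φ : B.RightDual)
    (x v v' : U) :
    B.thetaL₂ h φ (rmul₂ E v v' (E.leftBimod.mapR B.comul B.comul_l (B.comul x))) =
      E.rmul 1 (E.src (B.evR φ v) * v') (B.comul x) := by
  rw [rmul_one_src_mul, ← B.coassoc]
  induction B.comul x using BalTensor.induction with
  | h0 => simp
  | ha y z hy hz => simp only [map_add, hy, hz]
  | ht a b =>
    rw [Bimod.mapL_tmul, thetaL₂_rmul₂_assoc, ← galoisL_tmul, thetaL_galoisL, actAux_tmul,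
      AeRing.rmul_tmul]

/-- `β_{φφ'}(u ⊗ v) = β_{φ'}(θ_φ(u ⊗ v₍₁₎) ⊗ v₍₂₎)`, where `θ_φ(u ⊗ v) = u₊ t(φ(u₋ v))` and
`β_φ = ε ∘ θ_φ`. -/
theorem betaL_mul (B : LeftBialgebroid E) (h : B.IsLeftHopf) (φ φ' : B.RightDual)
    (w : E.LTensor) :
    B.betaL h (φ * φ') w =
      B.betaL h φ' (B.thetaL₂ h φ (E.leftBimod.mapR B.comul B.comul_l w)) := by
  obtain ⟨z, rfl⟩ := h.2 w
  rw [betaL_galoisL]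
  induction z using BalTensor.induction with
  | h0 => simp
  | ha y z hy hz => simp only [map_add, hy, hz]
  | ht x y =>
    -- With $\Delta(y)=\sum_i f_i\otimes g_i$, both sides become
    -- $\sum_i\epsilon(x\,t(\varphi'(s(\varphi(f_i))g_i)))$.
    obtain ⟨ι, _, f, g, hy⟩ := BalTensor.exists_sum (B.comul y)
    rw [galoisL_tmul, sUpAux_tmul, B.mapR_rmul y f g hy, evR_mul, hy]
    simp [thetaL₂_mapR, betaL_rmul_comul, Finset.mul_sum]

theorem sUp_mul (B : LeftBialgebroid E) (h : B.IsLeftHopf) (φ φ' : B.RightDual) :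
    B.sUp h (φ * φ') = B.sUp h φ * B.sUp h φ' := by
  refine LeftDual.ext B fun u => ?_
  rw [evL_sUp, betaL_mul, Bimod.mapR_tmul, B.comul_one, thetaL₂_tmul, evL_mul,
    ← thetaL_tmul_one, evL_sUp]

theorem sUp_isHom (B : LeftBialgebroid E) (h : B.IsLeftHopf) :
    B.rightDualRing.IsHom B.leftDualRing (B.sUp h) where
  map_one := by
    -- The unit of each dual is the source of $1\in A$.
    have := B.sUp_srcR h 1
    rwa [← rightDualRing_src, ← leftDualRing_src, map_one B.rightDualRing.src,
      map_one B.leftDualRing.src] at this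
  map_mul := B.sUp_mul h
  map_src := B.sUp_srcR h
  map_tgt a := B.sUp_tgtR h (unop a)

end LeftBialgebroid

/-! ### Compatibility of $S^*$ with the coproducts dual to the product -/

namespace LeftBialgebroid

variable {k : Type u} {A : Type v} {U : Type w} [CommRing k] [Ring A] [Algebra k A]
  [Ring U] [Algebra k U] {E : AeRing k A U}

@[simp] theorem pairR_tmul (B : LeftBialgebroid E) (u v : U) (φ φ' : B.RightDual) :
    B.pairR u v (BalTensor.tmul _ _ φ φ') = B.evR φ (u * E.tgt (op (B.evR φ' v))) :=
  BalTensor.lift_tmul _ _ _ _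

@[simp] theorem pairL_tmul (B : LeftBialgebroid E) (u v : U) (ψ ψ' : B.LeftDual) :
    B.pairL u v (BalTensor.tmul _ _ ψ ψ') = B.evL ψ' (u * E.src (B.evL ψ v)) :=
  BalTensor.lift_tmul _ _ _ _

theorem betaL_rmul_galoisL (B : LeftBialgebroid E) (h : B.IsLeftHopf) {φ : B.RightDual}
    {ι : Type} [Fintype ι] {f g : ι → B.RightDual}
    (hφ : ∀ u v, B.evR φ (u * v) = ∑ i, B.evR (f i) (u * E.tgt (op (B.evR (g i) v))))
    (y : U) (z : E.OpTensor) :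
    B.betaL h φ (E.rmul 1 y (B.galoisL z)) =
      ∑ i, B.betaL h (f i) (E.rmul 1 (E.tgt (op (B.evR (g i) y))) (B.galoisL z)) := by
  induction z using BalTensor.induction with
  | h0 => simp
  | ha y z hy hz => simp only [map_add, hy, hz, Finset.sum_add_distrib]
  | ht a b => simp [AeRing.rmul_rmul, betaL_rmul_comul, hφ, Finset.mul_sum]

/-- Applying the preceding lemma at $\alpha_\ell^{-1}(v\otimes1)$ gives $\sum_i\beta_{f_i}(v\otimes
t(g_i(y)))$, and right $A$-linearity of $\beta_{f_i}$ extracts $g_i(y)$. -/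
theorem betaL_tmul (B : LeftBialgebroid E) (h : B.IsLeftHopf) {φ : B.RightDual}
    {ι : Type} [Fintype ι] {f g : ι → B.RightDual}
    (hφ : ∀ u v, B.evR φ (u * v) = ∑ i, B.evR (f i) (u * E.tgt (op (B.evR (g i) v))))
    (v y : U) :
    B.betaL h φ (BalTensor.tmul _ _ v y) = ∑ i, B.evL (B.sUp h (f i)) v * B.evR (g i) y := by
  have key := B.betaL_rmul_galoisL h hφ y (B.transL h v)
  simp only [galoisL_transL, AeRing.rmul_tmul, mul_one, one_mul] at key
  rw [key]
  refine Finset.sum_congr rfl fun i _ => ?_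
  rw [evL_sUp, ← betaL_tensorR]
  simp [Bimod.rAct_apply]

theorem betaL_rmul_left_galoisL (B : LeftBialgebroid E) (h : B.IsLeftHopf) (φ : B.RightDual)
    (v x y : U) :
    B.betaL h φ (E.rmul v 1 (B.galoisL (BalTensor.tmul _ _ x y))) =
      B.counit (x * E.src (B.betaL h φ (BalTensor.tmul _ _ v y))) := by
  rw [← betaL_diagMul, diagMul_tmul, galoisL_tmul, AeRing.rmul_rmul, one_mul, mul_one]

/-- `S^*` is compatible with the coproducts dual to the product of `U`. -/
theorem evL_sUp_mul (B : LeftBialgebroid E) (h : B.IsLeftHopf) {φ : B.RightDual}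
    {Z : B.rightDualRing.RTensor} (hφ : ∀ u v, B.evR φ (u * v) = B.pairR u v Z) (u v : U) :
    B.evL (B.sUp h φ) (u * v) = B.pairL u v ((B.sUp_isHom h).rtensor Z) := by
  obtain ⟨ι, _, f, g, rfl⟩ := BalTensor.exists_sum Z
  have hφ' : ∀ u v, B.evR φ (u * v) =
      ∑ i, B.evR (f i) (u * E.tgt (op (B.evR (g i) v))) := fun u v => by simp [hφ]
  -- The case $\alpha_\ell(z)=u\otimes1$ is the claim, since $uv\otimes1=(u\otimes1)(v\otimes1)$. On
  -- $z=x\otimes y$ equivariance turns both sides into $\sum_i\epsilon(x\,s(S^*(f_i)(v)g_i(y)))$.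
  have key : ∀ z, B.betaL h φ (E.rmul v 1 (B.galoisL z)) =
      ∑ i, B.betaL h (g i) (E.rmul (E.src (B.evL (B.sUp h (f i)) v)) 1 (B.galoisL z)) := by
    intro z
    induction z using BalTensor.induction with
    | h0 => simp
    | ha y z hy hz => simp only [map_add, hy, hz, Finset.sum_add_distrib]
    | ht x y =>
      simp only [betaL_rmul_left_galoisL, B.betaL_tmul h hφ', map_sum, Finset.mul_sum]
      refine Finset.sum_congr rfl fun i _ => ?_
      rw [← betaL_one_tmul B h (g i), ← betaL_tensorL]
      simp [Bimod.lAct_apply]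
  have key := key (B.transL h u)
  simp only [galoisL_transL, AeRing.rmul_tmul, mul_one] at key
  rw [evL_sUp, key, map_sum, map_sum]
  refine Finset.sum_congr rfl fun i _ => ?_
  rw [← evL_sUp]
  exact (B.pairL_tmul u v _ _).symm

/-! ### Dual bases and nondegeneracy of the pairings -/

theorem exists_dualBasis_tgt (B : LeftBialgebroid E) (h : E.FGProjTgt) :
    ∃ (n : ℕ) (e : Fin n → U) (f : Fin n → B.RightDual),
      ∀ v, ∑ i, E.tgt (op (B.evR (f i) v)) * e i = v := by
  let _ : Module Aᵐᵒᵖ U := Module.compHom U E.tgt.toRingHom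
  have hs : ∀ (a : Aᵐᵒᵖ) (u : U), a • u = E.tgt a * u := fun _ _ => rfl
  obtain ⟨_, _⟩ := h
  -- $U$ is a retract of a free module: the $e_i$ are the images of the standard basis under $p$,
  -- the $f_i$ the coordinates of the section $q$.
  obtain ⟨n, p, q, -, -, hpq⟩ := Module.Finite.exists_comp_eq_id_of_projective Aᵐᵒᵖ U
  refine ⟨n, fun i => p (Pi.single i 1), fun i => B.mkR
    { toFun := fun v => unop (q v i)
      map_add' := by simp
      map_smul' := fun c v => by
        -- The section is linear over $A^{op}$ only; $k$-linearity follows because $k$ acts on $U$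
        -- through the target map.
        have : c • v = (algebraMap k Aᵐᵒᵖ c) • v := by
          rw [hs, AlgHom.commutes, Algebra.smul_def]
        rw [this, map_smul]
        simp [Algebra.smul_def, Algebra.commutes] }
    (fun a u => by simp [← hs]), fun v => ?_⟩
  have hv := LinearMap.congr_fun hpq v
  rw [LinearMap.comp_apply, LinearMap.id_apply] at hv
  conv_rhs => rw [← hv, ← Finset.univ_sum_single (q v), map_sum]
  refine Finset.sum_congr rfl fun i _ => ?_
  rw [← hs, ← map_smul, ← Pi.single_smul]
  simp

theorem exists_dualBasis_src (B : LeftBialgebroid E) (h : E.FGProjSrc) :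
    ∃ (n : ℕ) (e : Fin n → U) (f : Fin n → B.LeftDual),
      ∀ v, ∑ i, E.src (B.evL (f i) v) * e i = v := by
  let _ : Module A U := Module.compHom U E.src.toRingHom
  have hs : ∀ (a : A) (u : U), a • u = E.src a * u := fun _ _ => rfl
  obtain ⟨_, _⟩ := h
  obtain ⟨n, p, q, -, -, hpq⟩ := Module.Finite.exists_comp_eq_id_of_projective A U
  refine ⟨n, fun i => p (Pi.single i 1), fun i => B.mkL
    { toFun := fun v => q v i
      map_add' := by simp
      map_smul' := fun c v => by
        have : c • v = (algebraMap k A c) • v := by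
          rw [hs, AlgHom.commutes, Algebra.smul_def]
        rw [this, map_smul]
        simp [Algebra.smul_def] }
    (fun a u => by simp [← hs]), fun v => ?_⟩
  have hv := LinearMap.congr_fun hpq v
  rw [LinearMap.comp_apply, LinearMap.id_apply] at hv
  conv_rhs => rw [← hv, ← Finset.univ_sum_single (q v), map_sum]
  refine Finset.sum_congr rfl fun i _ => ?_
  rw [← hs, ← map_smul, ← Pi.single_smul]
  simp

theorem evR_rAct (B : LeftBialgebroid E) (a : A) (φ : B.RightDual) (u : U) :
    B.evR (B.rightDualRing.rightBimod.rAct a φ) u = B.evR φ (u * E.tgt (op a)) :=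
  B.evR_mul_srcR a φ u

theorem evR_lAct (B : LeftBialgebroid E) (a : A) (φ : B.RightDual) (u : U) :
    B.evR (B.rightDualRing.rightBimod.lAct a φ) u = a * B.evR φ u :=
  B.evR_mul_tgtR a φ u

theorem evL_rAct (B : LeftBialgebroid E) (a : A) (ψ : B.LeftDual) (u : U) :
    B.evL (B.leftDualRing.rightBimod.rAct a ψ) u = B.evL ψ u * a :=
  B.evL_mul_srcL a ψ u

theorem evL_lAct (B : LeftBialgebroid E) (a : A) (ψ : B.LeftDual) (u : U) :
    B.evL (B.leftDualRing.rightBimod.lAct a ψ) u = B.evL ψ (u * E.src a) :=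
  B.evL_mul_tgtL a ψ u

/-- The map `U^*◂ ⊗_A ▸U^* → U^*`, `φ ⊗ φ' ↦ φ ◂ φ'(v)`. -/
def contractDualR (B : LeftBialgebroid E) (v : U) : B.rightDualRing.RTensor →ₗ[k] B.RightDual :=
  BalTensor.lift
    (LinearMap.mk₂ k (fun φ φ' => B.rightDualRing.rightBimod.rAct (B.evR φ' v) φ)
      (by intros; simp) (by intros; simp)
      (by intros; apply RightDual.ext B; simp [evR_rAct, mul_add])
      (by intros; apply RightDual.ext B; simp [evR_rAct]))
    (by intros; apply RightDual.ext B; simp [evR_rAct, evR_lAct, mul_assoc])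

@[simp] theorem contractDualR_tmul (B : LeftBialgebroid E) (v : U) (φ φ' : B.RightDual) :
    B.contractDualR v (BalTensor.tmul _ _ φ φ') =
      B.rightDualRing.rightBimod.rAct (B.evR φ' v) φ :=
  BalTensor.lift_tmul _ _ _ _

theorem evR_contractDualR (B : LeftBialgebroid E) (u v : U) (z : B.rightDualRing.RTensor) :
    B.evR (B.contractDualR v z) u = B.pairR u v z := by
  induction z using BalTensor.induction with
  | h0 => simp
  | ha y z hy hz => simp only [map_add, LinearMap.add_apply, hy, hz]
  | ht φ φ' => simp [evR_rAct]

/-- The map `U_*◂ ⊗_A ▸U_* → U_*`, `ψ ⊗ ψ' ↦ ψ(v) ▸ ψ'`. -/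
def contractDualL (B : LeftBialgebroid E) (v : U) : B.leftDualRing.RTensor →ₗ[k] B.LeftDual :=
  BalTensor.lift
    (LinearMap.mk₂ k (fun ψ ψ' => B.leftDualRing.rightBimod.lAct (B.evL ψ v) ψ')
      (by intros; apply LeftDual.ext B; simp [evL_lAct, mul_add])
      (by intros; apply LeftDual.ext B; simp [evL_lAct])
      (by intros; simp) (by intros; simp))
    (by intros; apply LeftDual.ext B; simp [evL_rAct, evL_lAct, mul_assoc])

@[simp] theorem contractDualL_tmul (B : LeftBialgebroid E) (v : U) (ψ ψ' : B.LeftDual) :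
    B.contractDualL v (BalTensor.tmul _ _ ψ ψ') =
      B.leftDualRing.rightBimod.lAct (B.evL ψ v) ψ' :=
  BalTensor.lift_tmul _ _ _ _

theorem evL_contractDualL (B : LeftBialgebroid E) (u v : U) (z : B.leftDualRing.RTensor) :
    B.evL (B.contractDualL v z) u = B.pairL u v z := by
  induction z using BalTensor.induction with
  | h0 => simp
  | ha y z hy hz => simp only [map_add, LinearMap.add_apply, hy, hz]
  | ht ψ ψ' => simp [evL_lAct]

theorem eq_sum_contractDualR (B : LeftBialgebroid E) {n : ℕ} {e : Fin n → U}
    {f : Fin n → B.RightDual} (hef : ∀ v, ∑ i, E.tgt (op (B.evR (f i) v)) * e i = v)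
    (φ : B.RightDual) :
    φ = ∑ i, B.rightDualRing.rightBimod.lAct (B.evR φ (e i)) (f i) := by
  refine RightDual.ext B fun u => ?_
  conv_lhs => rw [← hef u]
  simp [evR_lAct, evR_tgt_mul]

/-- A dual basis reconstructs $z=\sum_i c_{e_i}(z)\otimes f_i$, where
$c_v(\varphi\otimes\varphi')=\varphi\blacktriangleleft\varphi'(v)$; each $c_v(z)$ is determined by
the pairing. -/
theorem pairR_injective (B : LeftBialgebroid E) (h : E.FGProjTgt) {z z' : B.rightDualRing.RTensor}
    (hz : ∀ u v, B.pairR u v z = B.pairR u v z') : z = z' := by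
  obtain ⟨n, e, f, hef⟩ := B.exists_dualBasis_tgt h
  have key : ∀ z, z = ∑ i, BalTensor.tmul B.rightDualRing.rightBimod.rAct
      B.rightDualRing.rightBimod.lAct (B.contractDualR (e i) z) (f i) := by
    intro z
    induction z using BalTensor.induction with
    | h0 => simp
    | ha y z hy hz =>
      conv_lhs => rw [hy, hz]
      simp [BalTensor.add_tmul, Finset.sum_add_distrib]
    | ht φ φ' =>
      conv_lhs => rw [B.eq_sum_contractDualR hef φ', BalTensor.tmul_sum]
      simp [BalTensor.tmul_balanced]
  rw [key z, key z']
  refine Finset.sum_congr rfl fun i _ => ?_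
  congr 1
  exact RightDual.ext B fun u => by rw [evR_contractDualR, evR_contractDualR, hz]

/-- The same reconstruction with the legs exchanged: for $U_*$ it is the first leg that is
evaluated, so the dual basis appears there. -/
theorem pairL_injective (B : LeftBialgebroid E) (h : E.FGProjSrc) {z z' : B.leftDualRing.RTensor}
    (hz : ∀ u v, B.pairL u v z = B.pairL u v z') : z = z' := by
  obtain ⟨n, e, f, hef⟩ := B.exists_dualBasis_src h
  have hψ : ∀ ψ, ψ = ∑ i, B.leftDualRing.rightBimod.rAct (B.evL ψ (e i)) (f i) := by
    refine fun ψ => LeftDual.ext B fun u => ?_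
    conv_lhs => rw [← hef u]
    simp [evL_rAct, evL_src_mul]
  have key : ∀ z, z = ∑ i, BalTensor.tmul B.leftDualRing.rightBimod.rAct
      B.leftDualRing.rightBimod.lAct (f i) (B.contractDualL (e i) z) := by
    intro z
    induction z using BalTensor.induction with
    | h0 => simp
    | ha y z hy hz =>
      conv_lhs => rw [hy, hz]
      simp [BalTensor.tmul_add, Finset.sum_add_distrib]
    | ht ψ ψ' =>
      conv_lhs => rw [hψ ψ, BalTensor.sum_tmul]
      simp [BalTensor.tmul_balanced]
  rw [key z, key z']
  refine Finset.sum_congr rfl fun i _ => ?_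
  congr 1
  exact LeftDual.ext B fun u => by rw [evL_contractDualL, evL_contractDualL, hz]

theorem contractDualR_tensorL (B : LeftBialgebroid E) (v : U) (a : A)
    (z : B.rightDualRing.RTensor) :
    B.contractDualR v (B.rightDualRing.rightBimod.tensorL B.rightDualRing.rightBimod a z) =
      B.rightDualRing.rightBimod.lAct a (B.contractDualR v z) := by
  induction z using BalTensor.induction with
  | h0 => simp
  | ha y z hy hz => simp only [map_add, hy, hz]
  | ht φ φ' => simp [Bimod.lAct_rAct]

/-- The map `φ ⊗ z ↦ φ ⊗ c(z)` for `c(φ ⊗ φ') = φ ◂ φ'(v)`. -/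
def contractDualR₂ (B : LeftBialgebroid E) (v : U) :
    BalTensor B.rightDualRing.rightBimod.rAct
      (B.rightDualRing.rightBimod.tensorL B.rightDualRing.rightBimod) →ₗ[k]
      B.rightDualRing.RTensor :=
  BalTensor.map LinearMap.id (B.contractDualR v) (by intros; rfl) (B.contractDualR_tensorL v)

@[simp] theorem contractDualR₂_tmul (B : LeftBialgebroid E) (v : U) (φ : B.RightDual)
    (z : B.rightDualRing.RTensor) :
    B.contractDualR₂ v (BalTensor.tmul _ _ φ z) = BalTensor.tmul _ _ φ (B.contractDualR v z) :=
  BalTensor.map_tmul _ _ _ _ _ _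

/-- Nondegeneracy on the triple tensor product, as coassociativity requires: the dual basis strips
off the last leg and leaves the double case. -/
theorem pairR_contractDualR₂_injective (B : LeftBialgebroid E) (h : E.FGProjTgt)
    {z z' : BalTensor B.rightDualRing.rightBimod.rAct
      (B.rightDualRing.rightBimod.tensorL B.rightDualRing.rightBimod)}
    (hz : ∀ u v w, B.pairR u v (B.contractDualR₂ w z) = B.pairR u v (B.contractDualR₂ w z')) :
    z = z' := by
  obtain ⟨n, e, f, hef⟩ := B.exists_dualBasis_tgt h
  let X := B.rightDualRing.rightBimod
  let j (i : Fin n) : X.Tensor X →ₗ[k] BalTensor X.rAct (X.tensorL X) :=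
    BalTensor.map LinearMap.id ((BalTensor.mk X.rAct X.lAct).flip (f i)) (by intros; rfl)
      (by intros; simp)
  have hj : ∀ i φ φ', j i (BalTensor.tmul _ _ φ φ') =
      BalTensor.tmul _ _ φ (BalTensor.tmul _ _ φ' (f i)) :=
    fun i φ φ' => BalTensor.map_tmul _ _ _ _ _ _
  have key : ∀ z, z = ∑ i, j i (B.contractDualR₂ (e i) z) := by
    intro z
    induction z using BalTensor.induction with
    | h0 => simp
    | ha y z hy hz =>
      conv_lhs => rw [hy, hz]
      simp [Finset.sum_add_distrib]
    | ht φ z =>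
      induction z using BalTensor.induction with
      | h0 => simp
      | ha y z hy hz =>
        rw [BalTensor.tmul_add]
        conv_lhs => rw [hy, hz]
        simp only [map_add, Finset.sum_add_distrib]
      | ht φ' φ'' =>
        conv_lhs => rw [B.eq_sum_contractDualR hef φ'', BalTensor.tmul_sum, BalTensor.tmul_sum]
        simp [hj, ← BalTensor.tmul_balanced, X]
  rw [key z, key z']
  exact Finset.sum_congr rfl fun i _ =>
    congrArg (j i) (B.pairR_injective h fun u v => hz u v (e i))

end LeftBialgebroid

/-! ### The right bialgebroid structure on $U^*$ -/

namespace LeftBialgebroid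

variable {k : Type u} {A : Type v} {U : Type w} [CommRing k] [Ring A] [Algebra k A]
  [Ring U] [Algebra k U] {E : AeRing k A U}

/-- The element `φ(- v)` of `U^*`. -/
def translateR (B : LeftBialgebroid E) (v : U) : B.RightDual →ₗ[k] B.RightDual where
  toFun φ := B.mkR (B.evR φ ∘ₗ LinearMap.mulRight k v)
    (by intros; simp [mul_assoc, evR_tgt_mul])
  map_add' φ φ' := RightDual.ext B fun _ => rfl
  map_smul' c φ := RightDual.ext B fun _ => rfl

@[simp] theorem evR_translateR (B : LeftBialgebroid E) (φ : B.RightDual) (u v : U) :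
    B.evR (B.translateR v φ) u = B.evR φ (u * v) := rfl

theorem exists_dual_comul (B : LeftBialgebroid E) (h : E.FGProjTgt) :
    ∃ Δ : B.RightDual →ₗ[k] B.rightDualRing.RTensor,
      ∀ φ u v, B.pairR u v (Δ φ) = B.evR φ (u * v) := by
  obtain ⟨n, e, f, hef⟩ := B.exists_dualBasis_tgt h
  -- The coproduct is $\Delta(\varphi)=\sum_i\varphi(-\,e_i)\otimes f_i$, forced by the
  -- reconstruction formula.
  refine ⟨∑ i, (BalTensor.mk _ _).flip (f i) ∘ₗ B.translateR (e i), fun φ u v => ?_⟩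
  conv_rhs => rw [← hef v]
  simp [Finset.mul_sum, mul_assoc]

theorem pairR_tensorL (B : LeftBialgebroid E) (u v : U) (a : A) (z : B.rightDualRing.RTensor) :
    B.pairR u v (B.rightDualRing.rightBimod.tensorL B.rightDualRing.rightBimod a z) =
      a * B.pairR u v z := by
  induction z using BalTensor.induction with
  | h0 => simp
  | ha y z hy hz => simp only [map_add, mul_add, hy, hz]
  | ht φ φ' => simp [evR_lAct]

theorem pairR_tensorR (B : LeftBialgebroid E) (u v : U) (a : A) (z : B.rightDualRing.RTensor) :
    B.pairR u v (B.rightDualRing.rightBimod.tensorR B.rightDualRing.rightBimod a z) =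
      B.pairR u (v * E.tgt (op a)) z := by
  induction z using BalTensor.induction with
  | h0 => simp
  | ha y z hy hz => simp only [map_add, hy, hz]
  | ht φ φ' => simp [evR_rAct]

theorem pairR_lmul_src (B : LeftBialgebroid E) (u v : U) (a : A) (z : B.rightDualRing.RTensor) :
    B.pairR u v (B.rightDualRing.lmul (B.rightDualRing.src a) 1 z) =
      B.pairR (u * E.src a) v z := by
  induction z using BalTensor.induction with
  | h0 => simp
  | ha y z hy hz => simp only [map_add, hy, hz]
  | ht φ φ' => simp [evR_srcR_mul, mul_assoc, E.comm]

theorem pairR_lmul_tgt (B : LeftBialgebroid E) (u v : U) (a : A) (z : B.rightDualRing.RTensor) :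
    B.pairR u v (B.rightDualRing.lmul 1 (B.rightDualRing.tgt (op a)) z) =
      B.pairR u (E.src a * v) z := by
  induction z using BalTensor.induction with
  | h0 => simp
  | ha y z hy hz => simp only [map_add, hy, hz]
  | ht φ φ' => simp [evR_tgtR_mul]

/-- One half of multiplicativity of the dual coproduct: for $g=\varphi'$ the left side is
$(\varphi\varphi')(uv)$. The proof uses $\Delta(uv)=\Delta(u)\Delta(v)$, the splitting of $\varphi$
on products, and the Takeuchi condition. -/
theorem evR_mul_mul (B : LeftBialgebroid E) {φ : B.RightDual} (g : U →ₗ[k] A) (u v : U)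
    {ι κ : Type} [Fintype ι] [Fintype κ] {f f' : ι → B.RightDual} {p q : κ → U}
    (hφ : ∀ u v, B.evR φ (u * v) = ∑ i, B.evR (f i) (u * E.tgt (op (B.evR (f' i) v))))
    (hv : B.comul v = ∑ j, BalTensor.tmul _ _ (p j) (q j)) :
    B.convR φ g (B.comul (u * v)) =
      ∑ i, ∑ j, B.convR (f i) g (E.rmul 1 (E.src (B.evR (f' i) (p j)) * q j) (B.comul u)) := by
  rw [← diagMul_comul, hv, map_sum, map_sum, Finset.sum_comm]
  refine Finset.sum_congr rfl fun j _ => ?_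
  simp only [B.rmul_one_src_mul, diagMul_tmul]
  induction B.comul u using BalTensor.induction with
  | h0 => simp
  | ha y z hy hz => simp only [map_add, hy, hz, Finset.sum_add_distrib]
  | ht x y => simp [hφ, Finset.sum_mul]

/-- The other half: the pairing of a product of tensors, brought to the same normal form as in
`evR_mul_mul`. -/
theorem pairR_lmul (B : LeftBialgebroid E) (g : U →ₗ[k] A) (φ φ' : B.RightDual) (u v : U)
    {κ : Type} [Fintype κ] {p q : κ → U} {z : B.rightDualRing.RTensor}
    (hz : ∀ u v, B.pairR u v z = g (u * v))
    (hv : B.comul v = ∑ j, BalTensor.tmul _ _ (p j) (q j)) :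
    B.pairR u v (B.rightDualRing.lmul φ φ' z) =
      ∑ j, B.convR φ g (E.rmul 1 (E.src (B.evR φ' (p j)) * q j) (B.comul u)) := by
  obtain ⟨ι, _, m, n, hu⟩ := BalTensor.exists_sum (B.comul u)
  have key : B.pairR u v (B.rightDualRing.lmul φ φ' z) =
      ∑ j, ∑ i, B.pairR (E.src (B.evR φ (m i)) * n i) (E.src (B.evR φ' (p j)) * q j) z := by
    -- The expansion is linear in $z$ and holds for every $z$, whereas the pure tensors met in the
    -- induction need not satisfy `hz`.
    clear hz
    induction z using BalTensor.induction with
    | h0 => simp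
    | ha y z hy hz => simp only [map_add, hy, hz, Finset.sum_add_distrib]
    | ht α α' =>
      rw [AeRing.lmul_tmul, pairR_tmul, evR_mul, evR_mul, comul_mul_tgt, hu, hv, Finset.sum_comm]
      simp [Finset.mul_sum, mul_assoc]
  rw [key]
  simp [hz, hu, mul_assoc]

/-- The augmentation `φ ↦ φ(1)` of `U^*`. -/
def augR (B : LeftBialgebroid E) : B.RightDual →ₗ[k] A := B.evR.flip 1

theorem augR_apply (B : LeftBialgebroid E) (φ : B.RightDual) : B.augR φ = B.evR φ 1 := rfl

theorem augR_lAct (B : LeftBialgebroid E) (a : A) (φ : B.RightDual) :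
    B.augR (B.rightDualRing.rightBimod.lAct a φ) = a * B.augR φ := B.evR_lAct a φ 1

theorem augR_rAct (B : LeftBialgebroid E) (a : A) (φ : B.RightDual) :
    B.augR (B.rightDualRing.rightBimod.rAct a φ) = B.augR φ * a := by
  rw [augR_apply, augR_apply, evR_rAct, one_mul, ← evR_tgt_mul, mul_one]

theorem dualComul_lAct (B : LeftBialgebroid E) (h : E.FGProjTgt)
    {Δ : B.RightDual →ₗ[k] B.rightDualRing.RTensor}
    (hΔ : ∀ φ u v, B.pairR u v (Δ φ) = B.evR φ (u * v))
    (a : A) (φ : B.RightDual) :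
    Δ (B.rightDualRing.rightBimod.lAct a φ) =
      B.rightDualRing.rightBimod.tensorL B.rightDualRing.rightBimod a (Δ φ) :=
  B.pairR_injective h fun u v => by rw [pairR_tensorL, hΔ, hΔ, evR_lAct]

theorem dualComul_rAct (B : LeftBialgebroid E) (h : E.FGProjTgt)
    {Δ : B.RightDual →ₗ[k] B.rightDualRing.RTensor}
    (hΔ : ∀ φ u v, B.pairR u v (Δ φ) = B.evR φ (u * v))
    (a : A) (φ : B.RightDual) :
    Δ (B.rightDualRing.rightBimod.rAct a φ) =
      B.rightDualRing.rightBimod.tensorR B.rightDualRing.rightBimod a (Δ φ) :=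
  B.pairR_injective h fun u v => by rw [pairR_tensorR, hΔ, hΔ, evR_rAct, mul_assoc]

/-- Tested against the pairing, the Takeuchi condition is $(u\,s(a))v=u(s(a)v)$; the bimodule axioms
above reduce to identities in $U$ in the same way. -/
theorem dualComul_takeuchi (B : LeftBialgebroid E) (h : E.FGProjTgt)
    {Δ : B.RightDual →ₗ[k] B.rightDualRing.RTensor}
    (hΔ : ∀ φ u v, B.pairR u v (Δ φ) = B.evR φ (u * v))
    (φ : B.RightDual) : B.rightDualRing.IsRightTakeuchi (Δ φ) := fun a =>
  B.pairR_injective h fun u v => by rw [pairR_lmul_src, pairR_lmul_tgt, hΔ, hΔ, mul_assoc]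

/-- Both sides paired with $u,v,w$ give $\varphi(uvw)$. -/
theorem dualComul_coassoc (B : LeftBialgebroid E) (h : E.FGProjTgt)
    {Δ : B.RightDual →ₗ[k] B.rightDualRing.RTensor}
    (hΔ : ∀ φ u v, B.pairR u v (Δ φ) = B.evR φ (u * v))
    (φ : B.RightDual) :
    B.rightDualRing.rightBimod.assoc B.rightDualRing.rightBimod B.rightDualRing.rightBimod
      (B.rightDualRing.rightBimod.mapL Δ (B.dualComul_rAct h hΔ) (Δ φ)) =
    B.rightDualRing.rightBimod.mapR Δ (B.dualComul_lAct h hΔ) (Δ φ) := by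
  refine B.pairR_contractDualR₂_injective h fun u v w => ?_
  have hc : ∀ w φ, B.contractDualR w (Δ φ) = B.translateR w φ := fun w φ =>
    RightDual.ext B fun u => by rw [evR_contractDualR, hΔ, evR_translateR]
  have h1 : ∀ z, B.pairR u v (B.contractDualR₂ w (B.rightDualRing.rightBimod.mapR Δ
      (B.dualComul_lAct h hΔ) z)) = B.pairR u (v * w) z := by
    intro z
    induction z using BalTensor.induction with
    | h0 => simp
    | ha y z hy hz => simp only [map_add, hy, hz]
    | ht φ φ' => simp [hc]
  -- After reassociation, contracting the last leg is the right action of $\varphi'(w)$ on the first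
  -- two, which the pairing absorbs into $v$ as $v\,t(\varphi'(w))$.
  have h2 : ∀ z φ', B.contractDualR₂ w (B.rightDualRing.rightBimod.assoc
      B.rightDualRing.rightBimod B.rightDualRing.rightBimod (BalTensor.tmul _ _ z φ')) =
      B.rightDualRing.rightBimod.tensorR B.rightDualRing.rightBimod (B.evR φ' w) z := by
    intro z φ'
    induction z using BalTensor.induction with
    | h0 => simp
    | ha y z hy hz => simp only [map_add, BalTensor.add_tmul, hy, hz]
    | ht φ φ' => simp
  have h3 : ∀ z, B.pairR u v (B.contractDualR₂ w (B.rightDualRing.rightBimod.assoc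
      B.rightDualRing.rightBimod B.rightDualRing.rightBimod
      (B.rightDualRing.rightBimod.mapL Δ (B.dualComul_rAct h hΔ) z))) =
      B.pairR (u * v) w z := by
    intro z
    induction z using BalTensor.induction with
    | h0 => simp
    | ha y z hy hz => simp only [map_add, hy, hz]
    | ht φ φ' => rw [Bimod.mapL_tmul, h2, pairR_tensorR, hΔ, pairR_tmul, mul_assoc]
  rw [h1, h3, hΔ, hΔ, mul_assoc]

theorem dualComul_mul (B : LeftBialgebroid E) (h : E.FGProjTgt)
    {Δ : B.RightDual →ₗ[k] B.rightDualRing.RTensor}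
    (hΔ : ∀ φ u v, B.pairR u v (Δ φ) = B.evR φ (u * v))
    (φ φ' : B.RightDual) :
    Δ (φ * φ') =
      B.rightDualRing.rightTakeuchiMul (Δ φ') (B.dualComul_takeuchi h hΔ φ') (Δ φ) := by
  refine B.pairR_injective h fun u v => ?_
  obtain ⟨ι, _, f, g, hφ⟩ := BalTensor.exists_sum (Δ φ)
  obtain ⟨κ, _, p, q, hv⟩ := BalTensor.exists_sum (B.comul v)
  rw [hΔ, evR_mul, B.evR_mul_mul (B.evR φ') u v (f := f) (f' := g)
    (fun u v => by rw [← hΔ, hφ]; simp) hv, hφ, map_sum, map_sum]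
  refine Finset.sum_congr rfl fun i _ => ?_
  rw [AeRing.rightTakeuchiMul_tmul, B.pairR_lmul (B.evR φ') _ _ u v (hΔ φ') hv]

/-- Contracting a leg by the augmentation is pairing it with $1\in U$, so the counit axioms become
the unit laws of $U$. -/
theorem evR_contractL (B : LeftBialgebroid E) (u : U) (z : B.rightDualRing.RTensor) :
    B.evR (B.rightDualRing.rightBimod.contractL B.augR B.augR_rAct z) u = B.pairR 1 u z := by
  induction z using BalTensor.induction with
  | h0 => simp
  | ha y z hy hz => simp only [map_add, LinearMap.add_apply, hy, hz]
  | ht φ φ' =>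
    rw [Bimod.contractL_tmul, evR_lAct, pairR_tmul, augR_apply, ← evR_tgt_mul, one_mul, mul_one]

theorem evR_contractR (B : LeftBialgebroid E) (u : U) (z : B.rightDualRing.RTensor) :
    B.evR (B.rightDualRing.rightBimod.contractR B.augR B.augR_lAct z) u = B.pairR u 1 z := by
  induction z using BalTensor.induction with
  | h0 => simp
  | ha y z hy hz => simp only [map_add, LinearMap.add_apply, hy, hz]
  | ht φ φ' => rw [Bimod.contractR_tmul, evR_rAct, pairR_tmul, augR_apply]

/-- The right bialgebroid structure on `U^*`, given a coproduct dual to the product of `U`. -/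
def rightDualBialgebroid (B : LeftBialgebroid E) (h : E.FGProjTgt)
    (Δ : B.RightDual →ₗ[k] B.rightDualRing.RTensor)
    (hΔ : ∀ φ u v, B.pairR u v (Δ φ) = B.evR φ (u * v)) :
    RightBialgebroid B.rightDualRing where
  comul := Δ
  comul_l := B.dualComul_lAct h hΔ
  comul_r := B.dualComul_rAct h hΔ
  counit := B.augR
  counit_l := B.augR_lAct
  counit_r := B.augR_rAct
  coassoc := B.dualComul_coassoc h hΔ
  counit_comul φ := RightDual.ext B fun u => by rw [evR_contractL, hΔ, one_mul]
  comul_counit φ := RightDual.ext B fun u => by rw [evR_contractR, hΔ, mul_one]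
  comul_takeuchi := B.dualComul_takeuchi h hΔ
  comul_one := B.pairR_injective h fun u v => by
    rw [hΔ, pairR_tmul, evR_one, counit_mul_tgt]
  comul_mul := B.dualComul_mul h hΔ
  counit_one := B.counit_one
  counit_src_mul φ φ' := by
    rw [augR_apply, augR_apply, augR_apply, rightDualRing_src,
      evR_srcR_mul, evR_mul, comul_one, convR_tmul, one_mul, mul_one]
  counit_tgt_mul φ φ' := by
    rw [augR_apply, augR_apply, augR_apply, rightDualRing_tgt,
      evR_tgtR_mul, evR_mul, comul_one, convR_tmul]

theorem exists_isRightDual (B : LeftBialgebroid E) (h : E.FGProjTgt) :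
    ∃ R, B.IsRightDual R := by
  obtain ⟨Δ, hΔ⟩ := B.exists_dual_comul h
  exact ⟨B.rightDualBialgebroid h Δ hΔ, fun _ => rfl, fun φ u v => (hΔ φ u v).symm⟩

theorem IsRightDual.unique {B : LeftBialgebroid E} (h : E.FGProjTgt)
    {R R' : RightBialgebroid B.rightDualRing} (hR : B.IsRightDual R) (hR' : B.IsRightDual R') :
    R = R' :=
  RightBialgebroid.ext
    (LinearMap.ext fun φ => B.pairR_injective h fun u v => by
      rw [← hR.comul_eq, ← hR'.comul_eq])
    (LinearMap.ext fun φ => by rw [hR.counit_eq, hR'.counit_eq])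

theorem IsLeftDual.unique {B : LeftBialgebroid E} (h : E.FGProjSrc)
    {R R' : RightBialgebroid B.leftDualRing} (hR : B.IsLeftDual R) (hR' : B.IsLeftDual R') :
    R = R' :=
  RightBialgebroid.ext
    (LinearMap.ext fun φ => B.pairL_injective h fun u v => by
      rw [← hR.comul_eq, ← hR'.comul_eq])
    (LinearMap.ext fun φ => by rw [hR.counit_eq, hR'.counit_eq])

end LeftBialgebroid

/-! ### Transport of right bialgebroid structures along isomorphisms of $A^e$-rings -/

namespace AeRing

variable {k : Type u} {A : Type v} [CommRing k] [Ring A] [Algebra k A]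
variable {U : Type w} [Ring U] [Algebra k U] {W : Type w'} [Ring W] [Algebra k W]
variable {E : AeRing k A U} {E' : AeRing k A W} {F : U →ₗ[k] W}

@[simp] theorem IsHom.rtensor_tmul (h : E.IsHom E' F) (x y : U) :
    h.rtensor (BalTensor.tmul _ _ x y) = BalTensor.tmul _ _ (F x) (F y) :=
  BalTensor.map_tmul _ _ _ _ _ _

theorem IsHom.inverse (h : E.IsHom E' F) {G : W →ₗ[k] U} (hGF : ∀ x, G (F x) = x)
    (hFG : ∀ y, F (G y) = y) : E'.IsHom E G where
  map_one := by rw [← h.map_one, hGF]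
  map_mul x y := by conv_lhs => rw [← hFG x, ← hFG y, ← h.map_mul, hGF]
  map_src a := by rw [← h.map_src, hGF]
  map_tgt a := by rw [← h.map_tgt, hGF]

theorem IsHom.rtensor_rtensor (h : E.IsHom E' F) {G : W →ₗ[k] U} (hG : E'.IsHom E G)
    (hGF : ∀ x, G (F x) = x) (z : E.RTensor) : hG.rtensor (h.rtensor z) = z := by
  induction z using BalTensor.induction with
  | h0 => simp
  | ha y z hy hz => simp only [map_add, hy, hz]
  | ht x y => simp [hGF]

theorem IsHom.rtensor_tensorL (h : E.IsHom E' F) (a : A) (z : E.RTensor) :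
    h.rtensor (E.rightBimod.tensorL E.rightBimod a z) =
      E'.rightBimod.tensorL E'.rightBimod a (h.rtensor z) := by
  induction z using BalTensor.induction with
  | h0 => simp
  | ha y z hy hz => simp only [map_add, hy, hz]
  | ht x y => simp [h.map_lAct]

theorem IsHom.rtensor_tensorR (h : E.IsHom E' F) (a : A) (z : E.RTensor) :
    h.rtensor (E.rightBimod.tensorR E.rightBimod a z) =
      E'.rightBimod.tensorR E'.rightBimod a (h.rtensor z) := by
  induction z using BalTensor.induction with
  | h0 => simp
  | ha y z hy hz => simp only [map_add, hy, hz]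
  | ht x y => simp [h.map_rAct]

theorem IsHom.rtensor_lmul (h : E.IsHom E' F) (v v' : U) (z : E.RTensor) :
    h.rtensor (E.lmul v v' z) = E'.lmul (F v) (F v') (h.rtensor z) := by
  induction z using BalTensor.induction with
  | h0 => simp
  | ha y z hy hz => simp only [map_add, hy, hz]
  | ht x y => simp [h.map_mul]

/-- Needed even to state `IsHom.rtensor_rightTakeuchiMul`: the product in the target is defined only
for tensors in its Takeuchi product. -/
theorem IsHom.isRightTakeuchi (h : E.IsHom E' F) {z : E.RTensor} (hz : E.IsRightTakeuchi z) :
    E'.IsRightTakeuchi (h.rtensor z) := fun a => by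
  rw [← h.map_one, ← h.map_src, ← h.map_tgt, ← h.rtensor_lmul, hz, h.rtensor_lmul]

theorem IsHom.rtensor_rightTakeuchiMul (h : E.IsHom E' F) {y : E.RTensor}
    (hy : E.IsRightTakeuchi y) (z : E.RTensor) :
    h.rtensor (E.rightTakeuchiMul y hy z) =
      E'.rightTakeuchiMul (h.rtensor y) (h.isRightTakeuchi hy) (h.rtensor z) := by
  induction z using BalTensor.induction with
  | h0 => simp
  | ha y z hy hz => simp only [map_add, hy, hz]
  | ht x y => simp [h.rtensor_lmul]

/-- The map `F ⊗ (F ⊗ F)` for a morphism `F` of `Aᵉ`-rings. -/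
def IsHom.rtensor₃ (h : E.IsHom E' F) :
    BalTensor E.rightBimod.rAct (E.rightBimod.tensorL E.rightBimod) →ₗ[k]
      BalTensor E'.rightBimod.rAct (E'.rightBimod.tensorL E'.rightBimod) :=
  BalTensor.map F h.rtensor h.map_rAct h.rtensor_tensorL

@[simp] theorem IsHom.rtensor₃_tmul (h : E.IsHom E' F) (x : U) (z : E.RTensor) :
    h.rtensor₃ (BalTensor.tmul _ _ x z) = BalTensor.tmul _ _ (F x) (h.rtensor z) :=
  BalTensor.map_tmul _ _ _ _ _ _

theorem IsHom.rtensor₃_assoc (h : E.IsHom E' F) (z : E.RTensor) (y : U) :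
    h.rtensor₃ (E.rightBimod.assoc E.rightBimod E.rightBimod (BalTensor.tmul _ _ z y)) =
      E'.rightBimod.assoc E'.rightBimod E'.rightBimod (BalTensor.tmul _ _ (h.rtensor z) (F y)) := by
  induction z using BalTensor.induction with
  | h0 => simp
  | ha y z hy hz => simp only [map_add, BalTensor.add_tmul, hy, hz]
  | ht x y => simp

end AeRing

namespace RightBialgebroid

variable {k : Type u} {A : Type v} [CommRing k] [Ring A] [Algebra k A]
variable {U : Type w} [Ring U] [Algebra k U] {W : Type w'} [Ring W] [Algebra k W]
variable {E : AeRing k A U} {E' : AeRing k A W} {F : U →ₗ[k] W} {G : W →ₗ[k] U}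

/-- The coproduct `(F ⊗ F) Δ F⁻¹`. -/
def transportComul (R : RightBialgebroid E) (hF : E.IsHom E' F) (G : W →ₗ[k] U) :
    W →ₗ[k] E'.RTensor := hF.rtensor ∘ₗ R.comul ∘ₗ G

theorem transportComul_apply (R : RightBialgebroid E) (hF : E.IsHom E' F) (G : W →ₗ[k] U)
    (x : W) : R.transportComul hF G x = hF.rtensor (R.comul (G x)) := rfl

theorem transportComul_lAct (R : RightBialgebroid E) (hF : E.IsHom E' F) (hG : E'.IsHom E G)
    (a : A) (x : W) :
    R.transportComul hF G (E'.rightBimod.lAct a x) =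
      E'.rightBimod.tensorL E'.rightBimod a (R.transportComul hF G x) := by
  rw [transportComul_apply, hG.map_lAct, R.comul_l, hF.rtensor_tensorL, transportComul_apply]

theorem transportComul_rAct (R : RightBialgebroid E) (hF : E.IsHom E' F) (hG : E'.IsHom E G)
    (a : A) (x : W) :
    R.transportComul hF G (E'.rightBimod.rAct a x) =
      E'.rightBimod.tensorR E'.rightBimod a (R.transportComul hF G x) := by
  rw [transportComul_apply, hG.map_rAct, R.comul_r, hF.rtensor_tensorR, transportComul_apply]

theorem transportCounit_lAct (R : RightBialgebroid E) (hG : E'.IsHom E G) (a : A) (x : W) :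
    (R.counit ∘ₗ G) (E'.rightBimod.lAct a x) = a * (R.counit ∘ₗ G) x := by
  rw [LinearMap.comp_apply, hG.map_lAct, R.counit_l, LinearMap.comp_apply]

theorem transportCounit_rAct (R : RightBialgebroid E) (hG : E'.IsHom E G) (a : A) (x : W) :
    (R.counit ∘ₗ G) (E'.rightBimod.rAct a x) = (R.counit ∘ₗ G) x * a := by
  rw [LinearMap.comp_apply, hG.map_rAct, R.counit_r, LinearMap.comp_apply]

/-- Transport of a right bialgebroid structure along an isomorphism of `Aᵉ`-rings. -/
def transport (R : RightBialgebroid E) (hF : E.IsHom E' F) (hG : E'.IsHom E G)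
    (hGF : ∀ x, G (F x) = x) (hFG : ∀ y, F (G y) = y) : RightBialgebroid E' where
  comul := R.transportComul hF G
  comul_l := R.transportComul_lAct hF hG
  comul_r := R.transportComul_rAct hF hG
  counit := R.counit ∘ₗ G
  counit_l := R.transportCounit_lAct hG
  counit_r := R.transportCounit_rAct hG
  coassoc x := by
    have h1 : ∀ z, E'.rightBimod.mapR (R.transportComul hF G) (R.transportComul_lAct hF hG)
        (hF.rtensor z) = hF.rtensor₃ (E.rightBimod.mapR R.comul R.comul_l z) := by
      intro z
      induction z using BalTensor.induction with
      | h0 => simp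
      | ha y z hy hz => simp only [map_add, hy, hz]
      | ht x y => simp [transportComul_apply, hGF]
    have h2 : ∀ z, E'.rightBimod.assoc E'.rightBimod E'.rightBimod (E'.rightBimod.mapL
        (R.transportComul hF G) (R.transportComul_rAct hF hG) (hF.rtensor z)) =
        hF.rtensor₃ (E.rightBimod.assoc E.rightBimod E.rightBimod
          (E.rightBimod.mapL R.comul R.comul_r z)) := by
      intro z
      induction z using BalTensor.induction with
      | h0 => simp
      | ha y z hy hz => simp only [map_add, hy, hz]
      | ht x y => simp [transportComul_apply, hGF, hF.rtensor₃_assoc]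
    rw [transportComul_apply, h1, h2, R.coassoc]
  counit_comul x := by
    have key : ∀ z, E'.rightBimod.contractL (R.counit ∘ₗ G) (R.transportCounit_rAct hG)
        (hF.rtensor z) = F (E.rightBimod.contractL R.counit R.counit_r z) := by
      intro z
      induction z using BalTensor.induction with
      | h0 => simp
      | ha y z hy hz => simp only [map_add, hy, hz]
      | ht x y => simp [hGF, hF.map_lAct]
    rw [transportComul_apply, key, R.counit_comul, hFG]
  comul_counit x := by
    have key : ∀ z, E'.rightBimod.contractR (R.counit ∘ₗ G) (R.transportCounit_lAct hG)
        (hF.rtensor z) = F (E.rightBimod.contractR R.counit R.counit_l z) := by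
      intro z
      induction z using BalTensor.induction with
      | h0 => simp
      | ha y z hy hz => simp only [map_add, hy, hz]
      | ht x y => simp [hGF, hF.map_rAct]
    rw [transportComul_apply, key, R.comul_counit, hFG]
  comul_takeuchi x := hF.isRightTakeuchi (R.comul_takeuchi (G x))
  comul_one := by
    rw [transportComul_apply, hG.map_one, R.comul_one, hF.rtensor_tmul, hF.map_one]
  comul_mul x y := by
    rw [transportComul_apply, hG.map_mul, R.comul_mul, hF.rtensor_rightTakeuchiMul]
    rfl
  counit_one := by rw [LinearMap.comp_apply, hG.map_one, R.counit_one]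
  counit_src_mul x y := by
    simp only [LinearMap.comp_apply, hG.map_mul, hG.map_src]
    exact R.counit_src_mul _ _
  counit_tgt_mul x y := by
    simp only [LinearMap.comp_apply, hG.map_mul, hG.map_tgt]
    exact R.counit_tgt_mul _ _

theorem isHom_transport (R : RightBialgebroid E) (hF : E.IsHom E' F) (hG : E'.IsHom E G)
    (hGF : ∀ x, G (F x) = x) (hFG : ∀ y, F (G y) = y) :
    R.IsHom (R.transport hF hG hGF hFG) F where
  toIsHom := hF
  map_counit x := congrArg R.counit (hGF x)
  map_comul x := congrArg (fun x => hF.rtensor (R.comul x)) (hGF x)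

theorem IsHom.inverse {R : RightBialgebroid E} {R' : RightBialgebroid E'} (h : R.IsHom R' F)
    (hGF : ∀ x, G (F x) = x) (hFG : ∀ y, F (G y) = y) : R'.IsHom R G where
  toIsHom := h.toIsHom.inverse hGF hFG
  map_counit y := by rw [← h.map_counit, hFG]
  map_comul y := by
    conv_rhs => rw [← hFG y, h.map_comul, h.toIsHom.rtensor_rtensor _ hGF]

end RightBialgebroid

/-! ### The dual structure on $U_*$ and the conclusion -/

/-- Supplies existence for $U_*$ with no mirrored verification of the axioms. Duality of the
coproduct is `evL_sUp_mul` at $G(\psi)$; no order of legs is reversed, since the pairing for $U_*$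
already evaluates them in the opposite order. -/
theorem LeftBialgebroid.IsRightDual.isLeftDual_transport {k : Type u} {A : Type v} {U : Type w}
    [CommRing k] [Ring A] [Algebra k A] [Ring U] [Algebra k U] {E : AeRing k A U}
    {B : LeftBialgebroid E} {R : RightBialgebroid B.rightDualRing} (hR : B.IsRightDual R)
    (h : B.IsLeftHopf) {G : B.LeftDual →ₗ[k] B.RightDual}
    (hG : B.leftDualRing.IsHom B.rightDualRing G) (hGF : ∀ φ, G (B.sUp h φ) = φ)
    (hFG : ∀ ψ, B.sUp h (G ψ) = ψ) :
    B.IsLeftDual (R.transport (B.sUp_isHom h) hG hGF hFG) where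
  counit_eq ψ := (hR.counit_eq (G ψ)).trans (by rw [← B.evL_sUp_one h, hFG])
  comul_eq ψ u v := by
    have := B.evL_sUp_mul h (hR.comul_eq (G ψ)) u v
    rwa [hFG] at this

end Bialgebroid

theorem mainTheorem2 {k : Type*} {A : Type*} {U : Type*} [CommRing k] [Ring A] [Algebra k A]
    [Ring U] [Algebra k U] {E : Bialgebroid.AeRing k A U} (B : Bialgebroid.LeftBialgebroid E)
    (hl : B.IsLeftHopf) (hr : B.IsRightHopf) :
    -- `S^*` and `S_*` are inverse to each other
    (∀ φ, B.sDown hr (B.sUp hl φ) = φ) ∧ (∀ ψ, B.sUp hl (B.sDown hr ψ) = ψ) ∧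
    -- they are morphisms of `Aᵉ`-rings with augmentation
    B.rightDualRing.IsHom B.leftDualRing (B.sUp hl) ∧
    (∀ φ, B.evL (B.sUp hl φ) 1 = B.evR φ 1) ∧
    B.leftDualRing.IsHom B.rightDualRing (B.sDown hr) ∧
    (∀ ψ, B.evR (B.sDown hr ψ) 1 = B.evL ψ 1) ∧
    -- the case of finitely generated projective `▷U` and `U◁`: the duals are right bialgebroids,
    -- and `(S^*, id)` and `(S_*, id)` are morphisms of right bialgebroids
    (E.FGProjSrc → E.FGProjTgt →
      (∃! R, B.IsRightDual R) ∧ (∃! R', B.IsLeftDual R') ∧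
      ∀ R R', B.IsRightDual R → B.IsLeftDual R' →
        R.IsHom R' (B.sUp hl) ∧ R'.IsHom R (B.sDown hr)) := by
  have hdu := B.sDown_sUp hl hr
  have hud := B.sUp_sDown hl hr
  have hU := B.sUp_isHom hl
  have hD := hU.inverse hdu hud
  refine ⟨hdu, hud, hU, B.evL_sUp_one hl, hD, fun ψ => ?_, fun hs ht => ?_⟩
  · rw [← B.evL_sUp_one hl, hud]
  · obtain ⟨R₀, hR₀⟩ := B.exists_isRightDual ht
    refine ⟨⟨R₀, hR₀, fun R hR => hR.unique ht hR₀⟩,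
      ⟨_, hR₀.isLeftDual_transport hl hD hdu hud, fun R' hR' => hR'.unique hs
        (hR₀.isLeftDual_transport hl hD hdu hud)⟩, fun R R' hR hR' => ?_⟩
    -- Uniqueness replaces the given structure on $U_*$ by the transport of $R$, for which
    -- compatibility with $S^*$ is built in.
    obtain rfl := hR'.unique hs (hR.isLeftDual_transport hl hD hdu hud)
    have hom := R.isHom_transport hU hD hdu hud
    exact ⟨hom, hom.inverse hdu hud⟩
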